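/- Let $n>3$ and let $\mathcal K_n$ be the network with parties $A_1,\dots,A_n$ and one bipartite source $S_{jj'}$, connected to $A_j$ and $A_{j'}$, for each pair $1\le j<j'\le n$. Consider the following quantum strategy on $\mathcal K_n$. Every source distributes the maximally entangled two-qubit state $\frac1{\sqrt2}(|00\rangle+|11\rangle)$. The parties are placed on a circle in the order $A_1,\dots,A_n$, and each party sorts her $n-1$ received qubits in clockwise order of the other party connected to the corresponding source (so that the first and the last qubit come from the sources shared with her two neighbors on the circle). Party $A_j$ measures them in the orthonormal basis $$\big\{|x\rangle : x\in\{0,1\}^{n-1}\big\}\setminus\{|01\cdots10\rangle,|10\cdots01\rangle\}\ \cup\ \{|v_{j,1}\rangle,|v_{j,2}\rangle\},\qquad |v_{j,r}\rangle=\omega^{(1)}_{j,r}|01\cdots10\rangle+\omega^{(2)}_{j,r}|10\cdots01\rangle ,$$ where the $\omega^{(t)}_{j,r}\in\mathbb C$ are such that $|v_{j,1}\rangle,|v_{j,2}\rangle$ are orthonormal, and outputs the label of the obtained basis vector. Then, for every $n>3$, there are coefficients $\omega^{(t)}_{j,r}$ (with $|v_{j,1}\rangle,|v_{j,2}\rangle$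 orthonormal for each $j$) such that this strategy is a Color-Matching strategy with two colors, each taken with probability $\frac12$, and its outcome distribution $P(a_1,\dots,a_n)$ is nonlocal. Here: * *Color-Matching with two colors* means that each source distributes a superposition of vectors in which all its parties receive the same color $c\in\{0,1\}$, the color $c$ having total weight $\frac12$, and that for each color $c$ every party has an output whose projector is the projector on "all received colors equal $c$". * *Nonlocal* means that there is no classical strategy producing $P$: there are no independent random variables $s_{jj'}$ (one for each source, with values in arbitrary probability spaces) and no local response functions $P(a_j\mid \{s_e : e \ni j\})$ such that $$P(a_1,\dots,a_n)=\mathbb E\Big[\prod_{j=1}^n P\big(a_j\mid \{s_e : e\ni j\}\big)\Big]\quad\text{for all } a_1,\dots,a_n .$$ -/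

import Mathlib

universe u

open MeasureTheory

/-! ### Networks -/

/-- A network with sources `I` and parties `J`: a bipartite graph (`Conn i j` means that the source
`i` is connected to the party `j`) in which no source is redundant, i.e. no source is connected to
all the parties to which another source is connected. -/
structure Network (I J : Type) where
  Conn : I → J → Prop
  irredundant : ∀ i i' : I, i ≠ i' → ∃ j, Conn i' j ∧ ¬ Conn i j

namespace Network

variable {I J : Type} (N : Network I J)

/-- The sources connected to the party `j`. -/
abbrev SourcesOf (j : J) : Type := {i : I // N.Conn i j}

/-- The parties connected to the source `i`. -/
abbrev PartiesOf (i : I) : Type := {j : J // N.Conn i j}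

end Network

/-! ### Classical strategies -/

/-- A classical strategy on `N` with outputs `O j`: the sources draw independent values
`s i ∈ S i` with laws `law i`, and the party `j` outputs `a` with probability
`response j s a` depending only on the values of the sources connected to `j`. -/
structure ClassicalStrategy {I J : Type} (N : Network I J) (O : J → Type) [∀ j, Fintype (O j)] where
  S : I → Type u
  [measurableSpace : ∀ i, MeasurableSpace (S i)]
  law : ∀ i, ProbabilityMeasure (S i)
  response : ∀ j, (∀ i : N.SourcesOf j, S i) → O j → ℝ
  measurable_response : ∀ j a, Measurable fun s => response j s a
  response_nonneg : ∀ j s a, 0 ≤ response j s a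
  response_sum : ∀ j s, ∑ a, response j s a = 1

attribute [instance] ClassicalStrategy.measurableSpace

/-- The joint distribution of the outputs of a classical strategy. -/
noncomputable def ClassicalStrategy.prob {I J : Type} [Fintype I] [Fintype J] {N : Network I J}
    {O : J → Type} [∀ j, Fintype (O j)] (c : ClassicalStrategy.{u} N O) (a : ∀ j, O j) : ℝ :=
  ∫ s, ∏ j, c.response j (fun i => s i) (a j) ∂(Measure.pi fun i => (c.law i : Measure (c.S i)))

/-- A joint distribution of the outputs is local if some classical strategy produces it. -/
def IsLocal {I J : Type} [Fintype I] [Fintype J] (N : Network I J) {O : J → Type}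
    [∀ j, Fintype (O j)] (P : (∀ j, O j) → ℝ) : Prop :=
  ∃ c : ClassicalStrategy.{u} N O, ∀ a, c.prob a = P a

/-! ### Quantum strategies -/

section Quantum

variable {I J : Type} [Fintype I] [DecidableEq I] [Fintype J] [DecidableEq J]

/-- A quantum strategy on `N`: to each arrow `i → j` belongs the Hilbert space `ℂ ^ dim i j`, the
source `i` distributes a pure state in the tensor product of the spaces of its arrows (written in
the product basis), and the party `j` performs a projective measurement on the tensor product of
the spaces of the arrows that arrive at `j`. -/
structure QuantumStrategy (N : Network I J) [DecidableRel N.Conn] (O : J → Type)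
    [∀ j, Fintype (O j)] where
  dim : I → J → ℕ
  state : ∀ i, EuclideanSpace ℂ (∀ j : N.PartiesOf i, Fin (dim i j))
  norm_state : ∀ i, ‖state i‖ = 1
  meas : ∀ j, O j →
    Matrix (∀ i : N.SourcesOf j, Fin (dim i j)) (∀ i : N.SourcesOf j, Fin (dim i j)) ℂ
  isStarProjection_meas : ∀ j a, IsStarProjection (meas j a)
  sum_meas : ∀ j, ∑ a, meas j a = 1

namespace QuantumStrategy

variable {N : Network I J} [DecidableRel N.Conn] {O : J → Type} [∀ j, Fintype (O j)]

/-- The product basis of the tensor product of the spaces of all arrows of the network. -/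
abbrev Config (Q : QuantumStrategy N O) : Type := ∀ (i : I) (j : N.PartiesOf i), Fin (Q.dim i j)

/-- The global state `⨂ᵢ |ψᵢ⟩⟨ψᵢ|`. -/
noncomputable def globalState (Q : QuantumStrategy N O) : Matrix Q.Config Q.Config ℂ :=
  Matrix.of fun x y => ∏ i, (Q.state i (x i) * star (Q.state i (y i)))

/-- The measurement operator `⨂ⱼ Π_{a j}`. -/
noncomputable def globalMeas (Q : QuantumStrategy N O) (a : ∀ j, O j) :
    Matrix Q.Config Q.Config ℂ :=
  Matrix.of fun x y =>
    ∏ j, Q.meas j (a j) (fun i => x i.1 ⟨j, i.2⟩) (fun i => y i.1 ⟨j, i.2⟩)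

/-- The joint distribution `Tr (⨂ᵢ |ψᵢ⟩⟨ψᵢ| · ⨂ⱼ Π_{a j})` of the outputs
(the trace is a nonnegative real number). -/
noncomputable def prob (Q : QuantumStrategy N O) (a : ∀ j, O j) : ℝ :=
  (Matrix.trace (Q.globalState * Q.globalMeas a)).re

/-- `Q` is a Color-Matching strategy with colors `Fin C` and color distribution `p`: every basis
vector of every arrow carries a color; every source distributes a superposition of vectors with
the same color on all its arrows, with total weight `p c` on the color `c`; and for each color `c`
every party has an output whose projector is the projector on "all received colors are `c`". -/
def IsColorMatching (Q : QuantumStrategy N O) (C : ℕ) (p : Fin C → ℝ) : Prop :=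
  ∃ (col : ∀ i j, Fin (Q.dim i j) → Fin C) (out : ∀ j, Fin C → O j),
    (∀ j, Function.Injective (out j)) ∧
    (∀ i x, Q.state i x ≠ 0 → ∃ c, ∀ j : N.PartiesOf i, col i j (x j) = c) ∧
    (∀ i c, ∑ x with ∀ j : N.PartiesOf i, col i j (x j) = c, ‖Q.state i x‖ ^ 2 = p c) ∧
    (∀ j c, Q.meas j (out j c) =
      Matrix.diagonal fun x => if ∀ i : N.SourcesOf j, col i j (x i) = c then 1 else 0)

end QuantumStrategy

end Quantum

/-! ### Measurements in an orthonormal basis -/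

/-- The operator `|v⟩⟨v|`. -/
noncomputable def ketbra {ι : Type} (v : EuclideanSpace ℂ ι) : Matrix ι ι ℂ :=
  Matrix.of fun x y => v x * star (v y)

theorem isStarProjection_ketbra {ι : Type} [Fintype ι] [DecidableEq ι] (v : EuclideanSpace ℂ ι)
    (hv : ‖v‖ = 1) : IsStarProjection (ketbra v) := by
  have h1 : ∑ y, star (v y) * v y = 1 := by
    have h := inner_self_eq_norm_sq_to_K (𝕜 := ℂ) v
    rw [hv, EuclideanSpace.inner_eq_star_dotProduct] at h
    simpa [dotProduct, mul_comm] using h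
  constructor
  · ext x y
    simp only [ketbra, Matrix.mul_apply, Matrix.of_apply]
    calc ∑ k, v x * star (v k) * (v k * star (v y))
        = v x * (∑ k, star (v k) * v k) * star (v y) := by
          rw [Finset.mul_sum, Finset.sum_mul]
          exact Finset.sum_congr rfl fun k _ => by ring
      _ = _ := by rw [h1, mul_one]
  · ext x y
    simp [ketbra, Matrix.star_apply, mul_comm]

theorem sum_ketbra_eq_one {ι κ : Type} [Fintype ι] [DecidableEq ι] [Fintype κ] [DecidableEq κ]
    (e : κ → EuclideanSpace ℂ ι) (he : Orthonormal ℂ e) (hcard : Fintype.card ι = Fintype.card κ) :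
    ∑ k, ketbra (e k) = 1 := by
  let U : Matrix ι κ ℂ := Matrix.of fun x k => e k x
  have h1 : U.conjTranspose * U = 1 := by
    ext k l
    have h := (orthonormal_iff_ite.1 he) k l
    rw [PiLp.inner_apply] at h
    simpa [U, Matrix.mul_apply, Matrix.one_apply, mul_comm] using h
  have h2 : U * U.conjTranspose = 1 :=
    (Matrix.mul_eq_one_comm_of_card_eq _ _ _ hcard.symm).1 h1
  rw [← h2]
  ext x y
  simp [U, ketbra, Matrix.sum_apply, Matrix.mul_apply]

/-! ### The complete network with bipartite sources -/

/-- The sources of the complete network: pairs of parties `j < j'`. -/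
abbrev CompleteSource (n : ℕ) : Type := {p : Fin n × Fin n // p.1 < p.2}

/-- The network with `n` parties and one bipartite source for each pair of parties. -/
def completeNetwork (n : ℕ) : Network (CompleteSource n) (Fin n) where
  Conn e j := e.1.1 = j ∨ e.1.2 = j
  irredundant := by
    rintro ⟨⟨a, b⟩, hab⟩ ⟨⟨c, d⟩, hcd⟩ hne
    by_contra! h
    have h1 := h c (Or.inl rfl)
    have h2 := h d (Or.inr rfl)
    apply hne
    simp only [Subtype.mk.injEq, Prod.mk.injEq]
    simp only at h1 h2 hab hcd
    omega

instance (n : ℕ) : DecidableRel (completeNetwork n).Conn := fun e j =>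
  inferInstanceAs (Decidable (e.1.1 = j ∨ e.1.2 = j))

/-- The parties being placed on a circle in the order `0, 1, …, n - 1`, a source is a boundary
source if its two parties are neighbors on the circle. -/
def IsBoundary {n : ℕ} (e : CompleteSource n) : Prop :=
  (e.1.2 : ℕ) = e.1.1 + 1 ∨ ((e.1.1 : ℕ) = 0 ∧ (e.1.2 : ℕ) + 1 = n)

instance {n : ℕ} (e : CompleteSource n) : Decidable (IsBoundary e) :=
  inferInstanceAs (Decidable (_ ∨ _))

/-- The two words `01⋯10` (for `t = 0`) and `10⋯01` (for `t = 1`) over the qubits received by the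
party `j`. In the clockwise order of these qubits the first and the last one come from the two
neighbors of `j` on the circle; they carry `t`, and all others carry `1 - t`. -/
def ringWord {n : ℕ} (j : Fin n) (t : Fin 2) : (completeNetwork n).SourcesOf j → Fin 2 :=
  fun e => if IsBoundary e.1 then t else 1 - t

/-- The outputs of the party `j`: the words other than `01⋯10` and `10⋯01`, and two ambiguous
outputs. -/
abbrev CompleteOutput (n : ℕ) (j : Fin n) : Type :=
  {x : (completeNetwork n).SourcesOf j → Fin 2 // ∀ t, x ≠ ringWord j t} ⊕ Fin 2

/-- The vector `|v_{j,r}⟩ = ω_{j,r}^{(1)} |01⋯10⟩ + ω_{j,r}^{(2)} |10⋯01⟩`; here `ω j r 0` and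
`ω j r 1` are the coefficients `ω_{j,r}^{(1)}` and `ω_{j,r}^{(2)}`. -/
noncomputable def ambiguousVector {n : ℕ} (ω : Fin n → Fin 2 → Fin 2 → ℂ) (j : Fin n)
    (r : Fin 2) : EuclideanSpace ℂ ((completeNetwork n).SourcesOf j → Fin 2) :=
  ω j r 0 • EuclideanSpace.single (ringWord j 0) 1 + ω j r 1 • EuclideanSpace.single (ringWord j 1) 1

/-- The measurement basis of the party `j`. -/
noncomputable def completeBasis {n : ℕ} (ω : Fin n → Fin 2 → Fin 2 → ℂ) (j : Fin n) :
    CompleteOutput n j → EuclideanSpace ℂ ((completeNetwork n).SourcesOf j → Fin 2)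
  | Sum.inl x => EuclideanSpace.single x.1 1
  | Sum.inr r => ambiguousVector ω j r

theorem completeBasis_orthonormal {n : ℕ} (ω : Fin n → Fin 2 → Fin 2 → ℂ) (j : Fin n)
    (hω : Orthonormal ℂ (ambiguousVector ω j)) : Orthonormal ℂ (completeBasis ω j) := by
  rw [orthonormal_iff_ite] at hω ⊢
  rintro (⟨x, hx⟩ | r) (⟨y, hy⟩ | s)
  · simp [completeBasis, EuclideanSpace.inner_single_left]
  · simp [completeBasis, ambiguousVector, EuclideanSpace.inner_single_left, hx]
  · simp [completeBasis, ambiguousVector, EuclideanSpace.inner_single_right, hy]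
  · simpa [completeBasis] using hω r s

theorem card_eq_card_sum {X : Type} [Fintype X] (w : Fin 2 → X) (hw : w 0 ≠ w 1)
    [Fintype {x // ∀ t, x ≠ w t}] :
    Fintype.card X = Fintype.card ({x // ∀ t, x ≠ w t} ⊕ Fin 2) := by
  classical
  have hinj : Function.Injective w := by
    intro a b h
    fin_cases a <;> fin_cases b <;> simp_all
  rw [Fintype.card_sum, Fintype.card_congr (Equiv.sumCompl fun x => ∀ t, x ≠ w t).symm,
    Fintype.card_sum]
  congr 1
  rw [← Set.card_range_of_injective hinj]
  exact Fintype.card_congr (Equiv.subtypeEquivRight fun x => by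
    simp [Set.mem_range, eq_comm, or_iff_not_imp_left])

theorem card_completeOutput {n : ℕ} (ω : Fin n → Fin 2 → Fin 2 → ℂ) (j : Fin n)
    (hω : Orthonormal ℂ (ambiguousVector ω j)) :
    Fintype.card ((completeNetwork n).SourcesOf j → Fin 2) = Fintype.card (CompleteOutput n j) := by
  have hne : ringWord j 0 ≠ ringWord j 1 := by
    intro h
    have hv : ∀ r, ambiguousVector ω j r
        = (ω j r 0 + ω j r 1) • EuclideanSpace.single (ringWord j 1) (1 : ℂ) := fun r => by
      rw [ambiguousVector, h, add_smul]
    have h01 : inner ℂ (ambiguousVector ω j 0) (ambiguousVector ω j 1) = 0 :=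
      hω.2 (show (0 : Fin 2) ≠ 1 by decide)
    have h0 : ω j 0 0 + ω j 0 1 ≠ 0 := fun h' => hω.ne_zero 0 (by rw [hv, h', zero_smul])
    have h1 : ω j 1 0 + ω j 1 1 ≠ 0 := fun h' => hω.ne_zero 1 (by rw [hv, h', zero_smul])
    rw [hv, hv, inner_smul_left, inner_smul_right, inner_self_eq_norm_sq_to_K,
      PiLp.norm_single] at h01
    simp only [norm_one, mul_eq_zero, map_eq_zero] at h01
    simp [h0, h1] at h01
  exact card_eq_card_sum (ringWord j) hne

theorem norm_ghz {ι : Type} [Fintype ι] [DecidableEq ι] (x y : ι) (h : x ≠ y) :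
    ‖((1 / Real.sqrt 2 : ℝ) : ℂ) •
      (EuclideanSpace.single x (1 : ℂ) + EuclideanSpace.single y (1 : ℂ))‖ = 1 := by
  have hsq := norm_add_sq_eq_norm_sq_add_norm_sq_of_inner_eq_zero (𝕜 := ℂ)
    (EuclideanSpace.single x (1 : ℂ)) (EuclideanSpace.single y (1 : ℂ))
    (by simp [EuclideanSpace.inner_single_left, h])
  simp only [PiLp.norm_single, norm_one] at hsq
  have h2 : ‖EuclideanSpace.single x (1 : ℂ) + EuclideanSpace.single y (1 : ℂ)‖ = Real.sqrt 2 := by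
    rw [← Real.sqrt_mul_self (norm_nonneg (EuclideanSpace.single x (1 : ℂ) + _)), hsq]
    norm_num
  rw [norm_smul, h2, Complex.norm_real, Real.norm_of_nonneg (by positivity),
    one_div_mul_cancel (by positivity)]

/-- The quantum strategy on the complete network in which every source distributes
`(|00⟩ + |11⟩) / √2` and the party `j` measures her `n - 1` qubits in the orthonormal basis
formed by the computational basis vectors other than `|01⋯10⟩`, `|10⋯01⟩` and by the two vectors
`|v_{j,r}⟩`. -/
noncomputable def completeStrategy {n : ℕ} (ω : Fin n → Fin 2 → Fin 2 → ℂ)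
    (hω : ∀ j, Orthonormal ℂ (ambiguousVector ω j)) :
    QuantumStrategy (completeNetwork n) (CompleteOutput n) where
  dim _ _ := 2
  state _ := ((1 / Real.sqrt 2 : ℝ) : ℂ) •
    (EuclideanSpace.single (fun _ => 0) 1 + EuclideanSpace.single (fun _ => 1) 1)
  norm_state e := by
    have hne : (fun _ => 0 : (completeNetwork n).PartiesOf e → Fin 2) ≠ fun _ => 1 := fun h =>
      absurd (congrFun h ⟨e.1.1, Or.inl rfl⟩) (by decide)
    exact norm_ghz _ _ hne
  meas j a := ketbra (completeBasis ω j a)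
  isStarProjection_meas j a :=
    isStarProjection_ketbra _ ((completeBasis_orthonormal ω j (hω j)).1 a)
  sum_meas j := sum_ketbra_eq_one _ (completeBasis_orthonormal ω j (hω j))
    (card_completeOutput ω j (hω j))

/-! Let every party measure the two ring words in a real rotated basis, with coefficients `(c, -s)`
for output `0` and `(s, c)` for output `1`. All parties can be ambiguous together only in the two
ring colorings `t = 0, 1`. These two histories interfere: the outputs `r` have probability `q * (∑
t, ∏ j, ω j (r j) t) ^ 2`, where `q` is 2 to the minus number of sources. One party `j₀` has its own
angle and the others share one, chosen so that the amplitude of "`0` at `j₀`, `1` elsewhere"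
cancels. Pair marginals, in contrast, show no interference.

Suppose a classical strategy gives the same distribution. Constant words of different colors at two
parties are incompatible, and the two parties share a single source, so the values of that source
split into two colors. The probabilities of the events "all outputs are the constant word `b`" make
these colors fair, and independence of the sources then forces every party to output the word of the
colors it receives whenever that word is unambiguous (`exists_coloring`). Ambiguous outputs are
therefore responses to ring words. Correlating one with a constant output of another party, which
reveals the color of their common source and hence `t`, shows that on the ring coloring `t` the
output `r` has conditional probability `‖ω j r t‖ ^ 2` (`integral_answer_inr_mul_box`).

On the ring coloring `1` the responses have the quantum marginals and never produce the forbidden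
pattern, so a Hardy-type inequality bounds a sum of pair probabilities from below
(`hardy_inequality`). The same pair probabilities are bounded above by those of both ring colorings
together, which are read off from the quantum side. With `m = n - 1` ordinary parties the two bounds
give `y₀ ^ 2 ≤ 2 * m * y₀ ^ 2 * y ^ 2`, which fails for small `y` and nonzero `y₀`. -/

/-! ### Independence and conditioning on one coordinate in a product measure. -/

section ProductMeasure

theorem DependsOn.comp_update {E : Type} [DecidableEq E] {X : E → Type u}
    {f : (∀ i, X i) → ℝ} {S : Finset E} (hf : DependsOn f (S : Set E))
    (e : E) (v : X e) :
    DependsOn (fun s => f (Function.update s e v)) ((S.erase e : Finset E) : Set E) := by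
  intro s t h
  refine hf fun i hi => ?_
  by_cases hie : i = e
  · subst hie; simp
  · simp only [Function.update_of_ne hie]
    exact h i (by simpa [hie] using hi)

variable {E : Type} [Fintype E] [DecidableEq E] {X : E → Type u} [∀ e, MeasurableSpace (X e)]
  (μ : ∀ e, Measure (X e)) [∀ e, IsProbabilityMeasure (μ e)]

/-- Resampling one coordinate independently does not change a product law. With Fubini this gives
conditioning on the value of `e`. -/
theorem measurePreserving_update (e : E) :
    MeasurePreserving (fun p : X e × (∀ i, X i) => Function.update p.2 e p.1)
      ((μ e).prod (Measure.pi μ)) (Measure.pi μ) := by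
  have hm : Measurable (fun p : X e × (∀ i, X i) => Function.update p.2 e p.1) :=
    measurable_update'.comp measurable_swap
  refine ⟨hm, (Measure.pi_eq fun B hB => ?_).symm⟩
  rw [Measure.map_apply hm (MeasurableSet.univ_pi hB)]
  have : (fun p : X e × (∀ i, X i) => Function.update p.2 e p.1) ⁻¹' Set.univ.pi B
      = B e ×ˢ Set.univ.pi (Function.update B e Set.univ) := by
    ext ⟨v, s⟩
    simp only [Set.mem_preimage, Set.mem_pi, Set.mem_univ, true_imp_iff, Set.mem_prod]
    constructor
    · intro h
      refine ⟨by simpa using h e, fun i => ?_⟩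
      by_cases hi : i = e
      · subst hi; simp
      · simpa [hi] using h i
    · rintro ⟨h1, h2⟩ i
      by_cases hi : i = e
      · subst hi; simpa using h1
      · simpa [hi] using h2 i
  rw [this, Measure.prod_prod, Measure.pi_pi,
    ← Finset.mul_prod_erase Finset.univ (fun i => μ i (B i)) (Finset.mem_univ e),
    ← Finset.mul_prod_erase Finset.univ (fun i => μ i (Function.update B e Set.univ i))
      (Finset.mem_univ e)]
  rw [Function.update_self, measure_univ, one_mul]
  congr 1
  exact Finset.prod_congr rfl fun i hi => by rw [Function.update_of_ne (Finset.ne_of_mem_erase hi)]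

theorem integral_eq_integral_update (e : E) {h : (∀ i, X i) → ℝ} (hm : Measurable h)
    (h0 : ∀ s, h s ∈ Set.Icc (0 : ℝ) 1) :
    ∫ s, h s ∂Measure.pi μ = ∫ v, ∫ s, h (Function.update s e v) ∂Measure.pi μ ∂μ e := by
  have hp := measurePreserving_update μ e
  rw [← hp.map_eq, integral_map hp.measurable.aemeasurable hm.aestronglyMeasurable,
    integral_prod]
  · rw [hp.map_eq]
  · exact Integrable.of_mem_Icc 0 1 (hm.comp hp.measurable).aemeasurable
      (Filter.Eventually.of_forall fun p => h0 _)

theorem integral_mul_of_dependsOn_disjoint {S T : Finset E} (hST : Disjoint S T)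
    {f g : (∀ i, X i) → ℝ} (hf : Measurable f) (hg : Measurable g)
    (hfS : DependsOn f (S : Set E)) (hgT : DependsOn g (T : Set E)) :
    ∫ s, f s * g s ∂Measure.pi μ = (∫ s, f s ∂Measure.pi μ) * ∫ s, g s ∂Measure.pi μ := by
  have hne : Nonempty (∀ i, X i) := nonempty_of_isProbabilityMeasure (Measure.pi μ)
  obtain ⟨s₀⟩ := hne
  have hind : ProbabilityTheory.iIndepFun (fun i (s : ∀ i, X i) => s i) (Measure.pi μ) :=
    ProbabilityTheory.iIndepFun_pi (X := fun i (x : X i) => x) fun i => aemeasurable_id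
  have h2 := hind.indepFun_finset S T hST fun i => measurable_pi_apply i
  -- A function depending only on `S` factors through restriction to `S`; filling the remaining
  -- coordinates from the base point `s₀` makes this factorization measurable.
  let ext (S : Finset E) (u : ∀ i : S, X i) : ∀ i, X i :=
    fun i => if h : i ∈ S then u ⟨i, h⟩ else s₀ i
  have hext (S : Finset E) : Measurable (ext S) := by
    refine measurable_pi_lambda _ fun i => ?_
    by_cases h : i ∈ S
    · simpa [ext, h] using measurable_pi_apply (⟨i, h⟩ : S)
    · simp [ext, h]
  have h3 := h2.comp (hf.comp (hext S)) (hg.comp (hext T))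
  have e1 : (f ∘ ext S) ∘ (fun s (i : S) => s i) = f := by
    ext s; exact hfS fun i hi => by simp [ext, Finset.mem_coe.1 hi]
  have e2 : (g ∘ ext T) ∘ (fun s (i : T) => s i) = g := by
    ext s; exact hgT fun i hi => by simp [ext, Finset.mem_coe.1 hi]
  rw [e1, e2] at h3
  exact h3.integral_fun_mul_eq_mul_integral hf.aestronglyMeasurable hg.aestronglyMeasurable

/-- Two functions with a vanishing product that have only the source `e` in common are separated
by the value of `e`. -/
theorem exists_separating_set {S T : Finset E} {e : E} (hST : S ∩ T ⊆ {e})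
    {f g : (∀ i, X i) → ℝ} (hf : Measurable f) (hg : Measurable g)
    (hf0 : ∀ s, f s ∈ Set.Icc (0 : ℝ) 1) (hg0 : ∀ s, g s ∈ Set.Icc (0 : ℝ) 1)
    (hfS : DependsOn f (S : Set E)) (hgT : DependsOn g (T : Set E))
    (hfg : ∫ s, f s * g s ∂Measure.pi μ = 0) :
    ∃ A : Set (X e), MeasurableSet A ∧ (∀ᵐ s ∂Measure.pi μ, s e ∉ A → f s = 0) ∧
      ∀ᵐ s ∂Measure.pi μ, s e ∈ A → g s = 0 := by
  classical
  let φ : X e → ℝ := fun v => ∫ s, f (Function.update s e v) ∂Measure.pi μ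
  let ψ : X e → ℝ := fun v => ∫ s, g (Function.update s e v) ∂Measure.pi μ
  have hup := (measurePreserving_update μ e).measurable
  have meas {h : (∀ i, X i) → ℝ} (hh : Measurable h) :
      Measurable fun v => ∫ s, h (Function.update s e v) ∂Measure.pi μ :=
    ((hh.comp hup).stronglyMeasurable.integral_prod_right' (ν := Measure.pi μ)).measurable
  have hφ : Measurable φ := meas hf
  have hψ : Measurable ψ := meas hg
  have mem {h : (∀ i, X i) → ℝ} (hh : Measurable h) (h0 : ∀ s, h s ∈ Set.Icc (0 : ℝ) 1) (v : X e) :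
      ∫ s, h (Function.update s e v) ∂Measure.pi μ ∈ Set.Icc (0 : ℝ) 1 := by
    refine ⟨integral_nonneg fun s => (h0 _).1, ?_⟩
    have hi : Integrable (fun s => h (Function.update s e v)) (Measure.pi μ) :=
      Integrable.of_mem_Icc 0 1 (hh.comp (measurable_update_left)).aemeasurable
        (Filter.Eventually.of_forall fun p => h0 _)
    calc _ ≤ ∫ s, (1 : ℝ) ∂Measure.pi μ := integral_mono hi (integrable_const _) fun s => (h0 _).2
      _ = 1 := by simp
  have hdisj : Disjoint (S.erase e) (T.erase e) := by
    rw [Finset.disjoint_left]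
    intro i hi hj
    have := hST (Finset.mem_inter.2 ⟨Finset.mem_of_mem_erase hi, Finset.mem_of_mem_erase hj⟩)
    exact Finset.ne_of_mem_erase hi (Finset.mem_singleton.1 this)
  -- Once the common coordinate `e` is fixed, `f` and `g` depend on disjoint coordinates, so the
  -- conditional mean of `f * g` is `φ * ψ`.
  have key : ∫ v, φ v * ψ v ∂μ e = 0 := by
    rw [← hfg, integral_eq_integral_update μ e (h := fun s => f s * g s) (hf.mul hg)
      (fun s => ⟨mul_nonneg (hf0 s).1 (hg0 s).1, mul_le_one₀ (hf0 s).2 (hg0 s).1 (hg0 s).2⟩)]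
    refine integral_congr_ae (Filter.Eventually.of_forall fun v => ?_)
    exact (integral_mul_of_dependsOn_disjoint μ hdisj (hf.comp measurable_update_left)
      (hg.comp measurable_update_left) (hfS.comp_update e v) (hgT.comp_update e v)).symm
  have key' : ∀ᵐ v ∂μ e, φ v * ψ v = 0 := by
    refine (integral_eq_zero_iff_of_nonneg
      (fun v => mul_nonneg (mem hf hf0 v).1 (mem hg hg0 v).1) ?_).1 key
    exact Integrable.of_mem_Icc 0 1 (hφ.mul hψ).aemeasurable (Filter.Eventually.of_forall fun v =>
      ⟨mul_nonneg (mem hf hf0 v).1 (mem hg hg0 v).1,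
        mul_le_one₀ (mem hf hf0 v).2 (mem hg hg0 v).1 (mem hg hg0 v).2⟩)
  have zero {h : (∀ i, X i) → ℝ} (hh : Measurable h) (h0 : ∀ s, h s ∈ Set.Icc (0 : ℝ) 1)
      {B : Set (X e)} (hB : MeasurableSet B)
      (hz : ∀ᵐ v ∂μ e, v ∈ B → ∫ s, h (Function.update s e v) ∂Measure.pi μ = 0) :
      ∀ᵐ s ∂Measure.pi μ, s e ∈ B → h s = 0 := by
    let h' : (∀ i, X i) → ℝ := fun s => B.indicator 1 (s e) * h s
    have hm' : Measurable h' :=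
      ((measurable_one.indicator hB).comp (measurable_pi_apply e)).mul hh
    have h0' : ∀ s, h' s ∈ Set.Icc (0 : ℝ) 1 := fun s => by
      by_cases hs : s e ∈ B <;> simp [h', hs, (h0 s).1, (h0 s).2]
    have hi : ∫ s, h' s ∂Measure.pi μ = 0 := by
      rw [integral_eq_integral_update μ e hm' h0']
      refine integral_eq_zero_of_ae ?_
      filter_upwards [hz] with v hv
      by_cases hvB : v ∈ B
      · simpa [h', hvB] using hv hvB
      · simp [h', hvB]
    have := (integral_eq_zero_iff_of_nonneg (fun s => (h0' s).1)
      (Integrable.of_mem_Icc 0 1 hm'.aemeasurable (Filter.Eventually.of_forall h0'))).1 hi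
    filter_upwards [this] with s hs hsB
    simpa [h', hsB] using hs
  -- The separating set consists of the values of `e` at which `f` has positive conditional mean;
  -- there the conditional mean of `g` must vanish almost everywhere.
  refine ⟨{v | φ v ≠ 0}, (hφ (measurableSet_singleton 0)).compl, ?_, ?_⟩
  · exact zero hf hf0 (B := {v | φ v ≠ 0}ᶜ) (hφ (measurableSet_singleton 0)).compl.compl
      (Filter.Eventually.of_forall fun v hv => not_not.1 hv)
  · refine zero hg hg0 (hφ (measurableSet_singleton 0)).compl ?_
    filter_upwards [key'] with v hv hv'
    exact (mul_eq_zero.1 hv).resolve_left hv'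

end ProductMeasure

/-! ### Quantum probabilities as sums over colorings of the sources. -/

section CompleteStrategyProbabilities

variable {n : ℕ}

/-- The colors that the party `j` receives if the sources have the colors `κ`. -/
def received (j : Fin n) {α : CompleteSource n → Type u} (κ : ∀ e, α e) :
    ∀ e : (completeNetwork n).SourcesOf j, α e.1 :=
  fun e => κ e.1

theorem ghz_apply {ι : Type} [Fintype ι] [DecidableEq ι] (x : ι → Fin 2) :
    (((1 / Real.sqrt 2 : ℝ) : ℂ) • (EuclideanSpace.single (fun _ => 0) 1 +
      EuclideanSpace.single (fun _ => 1) 1) : EuclideanSpace ℂ (ι → Fin 2)) x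
      = ∑ b : Fin 2, if x = fun _ => b then ((1 / Real.sqrt 2 : ℝ) : ℂ) else 0 := by
  simp only [PiLp.smul_apply, PiLp.add_apply, PiLp.single_apply, Fin.sum_univ_two,
    smul_eq_mul, mul_add, mul_ite, mul_one, mul_zero]

theorem sum_prod_ghz {E : Type} [Fintype E] [DecidableEq E] {ι : E → Type} [∀ e, Fintype (ι e)]
    [∀ e, DecidableEq (ι e)] (z : ℂ) (f : (∀ e, ι e → Fin 2) → ℂ) :
    ∑ x : ∀ e, ι e → Fin 2, (∏ e, ∑ b : Fin 2, if x e = fun _ => b then z else 0) * f x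
      = z ^ Fintype.card E * ∑ κ : E → Fin 2, f fun e _ => κ e := by
  have h1 (x : ∀ e, ι e → Fin 2) : (∏ e, ∑ b : Fin 2, if x e = fun _ => b then z else 0)
      = ∑ κ : E → Fin 2, if x = fun e _ => κ e then z ^ Fintype.card E else 0 := by
    rw [Fintype.prod_sum]
    refine Finset.sum_congr rfl fun κ _ => ?_
    split_ifs with h
    · subst h; simp
    · obtain ⟨e, he⟩ := Function.ne_iff.1 h
      exact Finset.prod_eq_zero (Finset.mem_univ e) (if_neg he)
  simp only [h1, Finset.sum_mul, ite_mul, zero_mul]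
  rw [Finset.sum_comm, Finset.mul_sum]
  exact Finset.sum_congr rfl fun κ _ => by simp

variable (ω : Fin n → Fin 2 → Fin 2 → ℂ) (hω : ∀ j, Orthonormal ℂ (ambiguousVector ω j))

/-- Both qubits of a source carry the same color, so ket and bra configurations reduce to colorings
`κ` and `κ'`. Each source contributes a factor `1 / √2` to each of them. -/
theorem completeStrategy_prob (a : ∀ j, CompleteOutput n j) :
    (completeStrategy ω hω).prob a = ((1 / 2 : ℂ) ^ Fintype.card (CompleteSource n) *
      ∑ κ : CompleteSource n → Fin 2, ∑ κ' : CompleteSource n → Fin 2,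
        ∏ j, ketbra (completeBasis ω j (a j)) (received j κ') (received j κ)).re := by
  have hz : ((1 / Real.sqrt 2 : ℝ) : ℂ) * ((1 / Real.sqrt 2 : ℝ) : ℂ) = 1 / 2 := by
    rw [← Complex.ofReal_mul, div_mul_div_comm, Real.mul_self_sqrt (by norm_num)]
    norm_num
  unfold QuantumStrategy.prob
  congr 1
  simp only [Matrix.trace, Matrix.diag_apply, Matrix.mul_apply, QuantumStrategy.globalState,
    QuantumStrategy.globalMeas, Matrix.of_apply, Finset.prod_mul_distrib]
  change ∑ x : ∀ (e : CompleteSource n), (completeNetwork n).PartiesOf e → Fin 2,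
    ∑ y : ∀ (e : CompleteSource n), (completeNetwork n).PartiesOf e → Fin 2,
      ((∏ e, (((1 / Real.sqrt 2 : ℝ) : ℂ) • (EuclideanSpace.single (fun _ => 0) 1 +
        EuclideanSpace.single (fun _ => 1) 1) :
          EuclideanSpace ℂ ((completeNetwork n).PartiesOf e → Fin 2)) (x e)) *
      (∏ e, star ((((1 / Real.sqrt 2 : ℝ) : ℂ) • (EuclideanSpace.single (fun _ => 0) 1 +
        EuclideanSpace.single (fun _ => 1) 1) :
          EuclideanSpace ℂ ((completeNetwork n).PartiesOf e → Fin 2)) (y e)))) *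
      (∏ j, ketbra (completeBasis ω j (a j)) (fun e => y e.1 ⟨j, e.2⟩)
        (fun e => x e.1 ⟨j, e.2⟩)) = _
  have hstar (e : CompleteSource n) (y : (completeNetwork n).PartiesOf e → Fin 2) :
      star (∑ b : Fin 2, if y = fun _ => b then ((1 / Real.sqrt 2 : ℝ) : ℂ) else 0)
      = ∑ b : Fin 2, if y = fun _ => b then ((1 / Real.sqrt 2 : ℝ) : ℂ) else 0 := by
    rw [star_sum]
    refine Finset.sum_congr rfl fun b _ => ?_
    split_ifs
    · exact Complex.conj_ofReal _
    · exact star_zero _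
  simp only [ghz_apply, hstar, mul_assoc, ← Finset.mul_sum]
  rw [sum_prod_ghz]
  simp only [sum_prod_ghz]
  rw [← Finset.mul_sum, ← mul_assoc, ← mul_pow, hz]
  rfl

/-- The weights `h` are meant to be indicators of an output at selected parties and `1` elsewhere,
which turns the left side into a marginal probability. -/
theorem sum_mul_completeStrategy_prob (h : ∀ j, CompleteOutput n j → ℝ) :
    ∑ a : ∀ j, CompleteOutput n j, (∏ j, h j (a j)) * (completeStrategy ω hω).prob a
      = ((1 / 2 : ℂ) ^ Fintype.card (CompleteSource n) *
      ∑ κ : CompleteSource n → Fin 2, ∑ κ' : CompleteSource n → Fin 2,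
        ∏ j, ∑ a, (h j a : ℂ) *
          ketbra (completeBasis ω j a) (received j κ') (received j κ)).re := by
  simp only [completeStrategy_prob, Fintype.prod_sum, Finset.prod_mul_distrib]
  simp only [← Complex.re_ofReal_mul, ← Complex.re_sum]
  congr 1
  simp only [Finset.mul_sum]
  rw [Finset.sum_comm]
  refine Finset.sum_congr rfl fun κ _ => ?_
  rw [Finset.sum_comm]
  refine Finset.sum_congr rfl fun κ' _ => Finset.sum_congr rfl fun a _ => ?_
  push_cast
  ring

/-- If all parties but `j₀` measure diagonally, the colors of the sources are classical. -/
theorem sum_mul_completeStrategy_prob_of_diagonal (h : ∀ j, CompleteOutput n j → ℝ) (j₀ : Fin n)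
    (hd : ∀ j ≠ j₀, ∀ x y, x ≠ y → ∑ a, (h j a : ℂ) * ketbra (completeBasis ω j a) x y = 0) :
    ∑ a : ∀ j, CompleteOutput n j, (∏ j, h j (a j)) * (completeStrategy ω hω).prob a
      = (1 / 2) ^ Fintype.card (CompleteSource n) *
      ∑ κ : CompleteSource n → Fin 2,
        ∏ j, ∑ a, h j a * ‖completeBasis ω j a (received j κ)‖ ^ 2 := by
  rw [sum_mul_completeStrategy_prob]
  have h1 (κ κ' : CompleteSource n → Fin 2) (hne : κ' ≠ κ) : ∏ j, ∑ a, (h j a : ℂ) *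
      ketbra (completeBasis ω j a) (received j κ') (received j κ) = 0 := by
    obtain ⟨e, he⟩ := Function.ne_iff.1 hne
    -- Every source has two ends, so at least one of them is a party with a diagonal operator; this
    -- party detects any difference between `κ` and `κ'` at `e`.
    obtain ⟨j, hj, hje⟩ : ∃ j ≠ j₀, (completeNetwork n).Conn e j := by
      by_cases hh : e.1.1 = j₀
      · exact ⟨e.1.2, fun h' => e.2.ne (hh.trans h'.symm), Or.inr rfl⟩
      · exact ⟨e.1.1, hh, Or.inl rfl⟩
    refine Finset.prod_eq_zero (Finset.mem_univ j) (hd j hj _ _ fun h' => he ?_)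
    exact congrFun h' ⟨e, hje⟩
  have h2 (κ : CompleteSource n → Fin 2) :
      (∑ κ' : CompleteSource n → Fin 2, ∏ j, ∑ a, (h j a : ℂ) *
        ketbra (completeBasis ω j a) (received j κ') (received j κ))
      = ((∏ j, ∑ a, h j a * ‖completeBasis ω j a (received j κ)‖ ^ 2 : ℝ) : ℂ) := by
    rw [Finset.sum_eq_single κ (fun κ' _ hne => h1 κ κ' hne) (by simp)]
    push_cast
    refine Finset.prod_congr rfl fun j _ => Finset.sum_congr rfl fun a _ => ?_
    simp only [ketbra, Matrix.of_apply]
    rw [← Complex.mul_conj']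
    rfl
  simp only [h2]
  rw [← Complex.ofReal_sum]
  rw [show ((1 / 2 : ℂ)) = ((1 / 2 : ℝ) : ℂ) by norm_num, ← Complex.ofReal_pow,
    ← Complex.ofReal_mul, Complex.ofReal_re]

theorem sum_ketbra_completeBasis (j : Fin n) (hω : Orthonormal ℂ (ambiguousVector ω j)) :
    ∑ a, ketbra (completeBasis ω j a) = 1 :=
  sum_ketbra_eq_one _ (completeBasis_orthonormal ω j hω) (card_completeOutput ω j hω)

theorem sum_norm_completeBasis_sq (j : Fin n) (hω : Orthonormal ℂ (ambiguousVector ω j))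
    (x : (completeNetwork n).SourcesOf j → Fin 2) :
    ∑ a, ‖completeBasis ω j a x‖ ^ 2 = 1 := by
  have h := congrFun (congrFun (sum_ketbra_completeBasis ω j hω) x) x
  simp only [Matrix.sum_apply, ketbra, Matrix.of_apply, Matrix.one_apply_eq] at h
  have : ((∑ a, ‖completeBasis ω j a x‖ ^ 2 : ℝ) : ℂ) = 1 := by
    rw [← h]
    push_cast
    refine Finset.sum_congr rfl fun a _ => ?_
    rw [← Complex.mul_conj']
    rfl
  exact_mod_cast this

theorem norm_completeBasis_inl_sq (j : Fin n) (b) (x : (completeNetwork n).SourcesOf j → Fin 2) :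
    ‖completeBasis ω j (Sum.inl b) x‖ ^ 2 = if x = b.1 then 1 else 0 := by
  simp only [completeBasis, PiLp.single_apply]
  split_ifs <;> simp

theorem sum_indicator_mul_ketbra (j : Fin n) (b)
    {x y : (completeNetwork n).SourcesOf j → Fin 2} (hxy : x ≠ y) :
    ∑ a, ((if a = Sum.inl b then 1 else 0 : ℝ) : ℂ) * ketbra (completeBasis ω j a) x y = 0 := by
  rw [Finset.sum_eq_single (Sum.inl b) (fun a _ ha => by rw [if_neg ha]; simp) (by simp)]
  simp only [if_true, ketbra, Matrix.of_apply, completeBasis, PiLp.single_apply]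
  split_ifs with h3 h4
  · exact absurd (h3.trans h4.symm) hxy
  all_goals simp

theorem sum_one_mul_ketbra (j : Fin n) (hω : Orthonormal ℂ (ambiguousVector ω j))
    {x y : (completeNetwork n).SourcesOf j → Fin 2} (hxy : x ≠ y) :
    ∑ a, ((1 : ℝ) : ℂ) * ketbra (completeBasis ω j a) x y = 0 := by
  simp only [Complex.ofReal_one, one_mul]
  rw [← Matrix.sum_apply, sum_ketbra_completeBasis ω j hω, Matrix.one_apply_ne hxy]

/-- The probability of the outputs `a`, `inl b` of two parties. -/
theorem sum_completeStrategy_prob_pair {j j' : Fin n} (hj : j ≠ j') (a : CompleteOutput n j) (b) :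
    ∑ o : ∀ k, CompleteOutput n k,
        (if o j = a ∧ o j' = Sum.inl b then (completeStrategy ω hω).prob o else 0)
      = (1 / 2) ^ Fintype.card (CompleteSource n) * ∑ κ : CompleteSource n → Fin 2,
        if received j' κ = b.1 then ‖completeBasis ω j a (received j κ)‖ ^ 2 else 0 := by
  let h : ∀ k, CompleteOutput n k → ℝ := fun k o =>
    (if hk : k = j then if hk ▸ o = a then 1 else 0 else 1) *
    (if hk : k = j' then if hk ▸ o = Sum.inl b then 1 else 0 else 1)
  have hk1 (k) (o : CompleteOutput n k) (h1 : k ≠ j) (h2 : k ≠ j') : h k o = 1 := by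
    simp [h, h1, h2]
  have hkj (o : CompleteOutput n j) : h j o = if o = a then 1 else 0 := by simp [h, hj]
  have hkj' (o : CompleteOutput n j') : h j' o = if o = Sum.inl b then 1 else 0 := by
    simp [h, hj.symm]
  have prod_two (f : Fin n → ℝ) (hf : ∀ k, k ≠ j → k ≠ j' → f k = 1) : ∏ k, f k = f j * f j' :=
    Fintype.prod_eq_mul j j' hj fun k hk => hf k hk.1 hk.2
  -- The exceptional party is `j`, since the output `a` may be ambiguous and its projector not
  -- diagonal.
  have main := sum_mul_completeStrategy_prob_of_diagonal ω hω h j (by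
    intro k hk x y hxy
    by_cases h2 : k = j'
    · subst h2
      simpa only [hkj'] using sum_indicator_mul_ketbra ω k b hxy
    · simpa only [hk1 k _ hk h2] using sum_one_mul_ketbra ω k (hω k) hxy)
  have lhs (o : ∀ k, CompleteOutput n k) :
      (if o j = a ∧ o j' = Sum.inl b then (completeStrategy ω hω).prob o else 0)
        = (∏ k, h k (o k)) * (completeStrategy ω hω).prob o := by
    rw [prod_two _ fun k h1 h2 => hk1 k _ h1 h2, hkj, hkj', ite_and]
    by_cases h1 : o j = a
    · by_cases h2 : o j' = Sum.inl b
      · rw [if_pos h1, if_pos h2, if_pos h1, if_pos h2, one_mul, one_mul]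
      · rw [if_pos h1, if_neg h2, if_neg h2, mul_zero, zero_mul]
    · rw [if_neg h1, if_neg h1, zero_mul, zero_mul]
  have rhs (κ : CompleteSource n → Fin 2) :
      ∏ k, ∑ a, h k a * ‖completeBasis ω k a (received k κ)‖ ^ 2
        = if received j' κ = b.1 then ‖completeBasis ω j a (received j κ)‖ ^ 2 else 0 := by
    rw [prod_two]
    · simp only [hkj, hkj', ite_mul, one_mul, zero_mul, Finset.sum_ite_eq', Finset.mem_univ,
        if_true, norm_completeBasis_inl_sq, mul_ite, mul_one, mul_zero]
    · intro k h1 h2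
      simp only [hk1 k _ h1 h2, one_mul, sum_norm_completeBasis_sq ω k (hω k)]
  simpa only [lhs, rhs] using main

/-- The probability of the output `a` of a party. -/
theorem sum_completeStrategy_prob_single (j : Fin n) (a : CompleteOutput n j) :
    ∑ o : ∀ k, CompleteOutput n k, (if o j = a then (completeStrategy ω hω).prob o else 0)
      = (1 / 2) ^ Fintype.card (CompleteSource n) * ∑ κ : CompleteSource n → Fin 2,
        ‖completeBasis ω j a (received j κ)‖ ^ 2 := by
  let h : ∀ k, CompleteOutput n k → ℝ := fun k o =>
    if hk : k = j then if hk ▸ o = a then 1 else 0 else 1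
  have hk1 (k) (o : CompleteOutput n k) (h1 : k ≠ j) : h k o = 1 := by
    simp [h, h1]
  have hkj (o : CompleteOutput n j) : h j o = if o = a then 1 else 0 := by simp [h]
  have main := sum_mul_completeStrategy_prob_of_diagonal ω hω h j (by
    intro k hk x y hxy
    simpa only [hk1 k _ hk] using sum_one_mul_ketbra ω k (hω k) hxy)
  convert! main using 1
  · refine Finset.sum_congr rfl fun o _ => ?_
    rw [Fintype.prod_eq_single j fun k h1 => hk1 k _ h1, hkj]
    split_ifs <;> simp_all
  · congr 1
    refine Finset.sum_congr rfl fun κ _ => ?_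
    rw [Fintype.prod_eq_single j]
    · simp [hkj]
    · intro k h1
      simp only [hk1 k _ h1, one_mul, sum_norm_completeBasis_sq ω k (hω k)]

/-- The probability of outputs in the computational basis. -/
theorem completeStrategy_prob_inl (b : ∀ j, {x : (completeNetwork n).SourcesOf j → Fin 2 //
      ∀ t, x ≠ ringWord j t}) :
    (completeStrategy ω hω).prob (fun j => Sum.inl (b j))
      = (1 / 2) ^ Fintype.card (CompleteSource n) * ∑ κ : CompleteSource n → Fin 2,
        if ∀ j, received j κ = (b j).1 then 1 else 0 := by
  -- Without parties there is none to take as the exceptional one.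
  rcases n with _ | n
  · rw [completeStrategy_prob]
    simp
  have main := sum_mul_completeStrategy_prob_of_diagonal ω hω
    (fun j a => if a = Sum.inl (b j) then 1 else 0) 0 
    (fun k _ x y hxy => sum_indicator_mul_ketbra ω k (b k) hxy)
  convert! main using 1
  · rw [Finset.sum_eq_single fun j => Sum.inl (b j)]
    · simp
    · intro a _ ha
      obtain ⟨j, hj⟩ := Function.ne_iff.1 ha
      rw [Finset.prod_eq_zero (Finset.mem_univ j) (if_neg hj), zero_mul]
    · simp
  · congr 1
    refine Finset.sum_congr rfl fun κ _ => ?_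
    simp only [ite_mul, one_mul, zero_mul, Finset.sum_ite_eq', Finset.mem_univ, if_true,
      norm_completeBasis_inl_sq]
    rw [Fintype.prod_boole]
    congr

/-- The coloring of the sources in which every party receives the word `ringWord j t`. -/
def ringColoring (n : ℕ) (t : Fin 2) : CompleteSource n → Fin 2 :=
  fun e => if IsBoundary e then t else 1 - t

theorem received_ringColoring (j : Fin n) (t : Fin 2) :
    received j (ringColoring n t) = ringWord j t := rfl

theorem ringWord_apply_injective (j : Fin n) (e : (completeNetwork n).SourcesOf j) {t t' : Fin 2}
    (h : ringWord j t e = ringWord j t' e) : t = t' := by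
  unfold ringWord at h
  split_ifs at h
  · exact h
  · revert h; revert t t'; decide

end CompleteStrategyProbabilities

/-! ### Common sources of parties, boundary sources and ring words. -/

section CompleteNetworkGeometry

variable {n : ℕ}

theorem exists_common_source {j k : Fin n} (h : j ≠ k) :
    ∃ e, (completeNetwork n).Conn e j ∧ (completeNetwork n).Conn e k := by
  rcases lt_or_gt_of_ne h with h | h
  · exact ⟨⟨(j, k), h⟩, Or.inl rfl, Or.inr rfl⟩
  · exact ⟨⟨(k, j), h⟩, Or.inr rfl, Or.inl rfl⟩

theorem common_source_unique {j k : Fin n} (h : j ≠ k) {e e' : CompleteSource n}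
    (hj : (completeNetwork n).Conn e j) (hk : (completeNetwork n).Conn e k)
    (hj' : (completeNetwork n).Conn e' j) (hk' : (completeNetwork n).Conn e' k) : e = e' := by
  obtain ⟨⟨a, b⟩, hab⟩ := e
  obtain ⟨⟨c, d⟩, hcd⟩ := e'
  change a = j ∨ b = j at hj
  change a = k ∨ b = k at hk
  change c = j ∨ d = j at hj'
  change c = k ∨ d = k at hk'
  change a < b at hab
  change c < d at hcd
  simp only [Subtype.mk.injEq, Prod.mk.injEq]
  omega

theorem exists_isBoundary (hn : 1 < n) (j : Fin n) :
    ∃ e, (completeNetwork n).Conn e j ∧ IsBoundary e := by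
  by_cases h : (j : ℕ) + 1 < n
  · exact ⟨⟨(j, ⟨j + 1, h⟩), Nat.lt_succ_self j⟩, Or.inl rfl, Or.inl rfl⟩
  · refine ⟨⟨(⟨0, by omega⟩, j), Fin.lt_def.2 (show 0 < (j : ℕ) by omega)⟩, Or.inr rfl,
      Or.inr ⟨rfl, ?_⟩⟩
    simp only
    omega

/-- For three parties on a circle all pairs are neighbors, whence the bound on `n`. Parties `0` and
`1` are joined to the party two steps ahead, the last party to `1`, and all others to `0`. -/
theorem exists_not_isBoundary (hn : 3 < n) (j : Fin n) :
    ∃ e, (completeNetwork n).Conn e j ∧ ¬ IsBoundary e := by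
  have main (a b : ℕ) (hb : b < n) (h : a + 1 < b) (h' : ¬ (a = 0 ∧ b + 1 = n))
      (hj : (j : ℕ) = a ∨ (j : ℕ) = b) :
      ∃ e, (completeNetwork n).Conn e j ∧ ¬ IsBoundary e := by
    refine ⟨⟨(⟨a, by omega⟩, ⟨b, hb⟩), Fin.lt_def.2 (show a < b by omega)⟩,
      hj.imp (fun h => Fin.ext h.symm) (fun h => Fin.ext h.symm), ?_⟩
    rintro (h1 | h1)
    · simp only at h1; omega
    · exact h' h1
  by_cases h0 : (j : ℕ) ≤ 1
  · exact main j (j + 2) (by omega) (by omega) (by omega) (Or.inl rfl)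
  · by_cases h1 : (j : ℕ) + 1 = n
    · exact main 1 j j.2 (by omega) (by omega) (Or.inr rfl)
    · exact main 0 j j.2 (by omega) (by omega) (Or.inr rfl)

theorem const_ne_ringWord (hn : 3 < n) (j : Fin n) (c t : Fin 2) :
    (fun _ => c) ≠ ringWord j t := by
  intro h
  obtain ⟨e, he, hb⟩ := exists_isBoundary (by omega) j
  obtain ⟨e', he', hb'⟩ := exists_not_isBoundary hn j
  have h1 := congrFun h ⟨e, he⟩
  have h2 := congrFun h ⟨e', he'⟩
  simp only [ringWord, hb, hb', if_true, if_false] at h1 h2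
  clear h; revert c t; decide

/-- The output "all received colors are `c`". -/
def constOutput (hn : 3 < n) (c : Fin 2) (j : Fin n) :
    {x : (completeNetwork n).SourcesOf j → Fin 2 // ∀ t, x ≠ ringWord j t} :=
  ⟨fun _ => c, const_ne_ringWord hn j c⟩

theorem ringWord_injective (hn : 1 < n) (j : Fin n) : Function.Injective (ringWord j) := by
  intro t t' h
  obtain ⟨e, he, -⟩ := exists_isBoundary hn j
  exact ringWord_apply_injective j ⟨e, he⟩ (congrFun h _)

theorem ringColoring_injective (hn : 1 < n) : Function.Injective (ringColoring n) := by
  intro t t' h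
  refine ringWord_injective hn ⟨0, by omega⟩ ?_
  rw [← received_ringColoring, h, received_ringColoring]

/-- Any two parties share a source, and its color determines which ring word each of them has
received; hence the choice is the same for all. -/
theorem eq_ringColoring_of_received (hn : 1 < n) {κ : CompleteSource n → Fin 2}
    (h : ∀ j, ∃ t, received j κ = ringWord j t) : ∃ t, κ = ringColoring n t := by
  choose τ hτ using h
  have hc (j k : Fin n) : τ j = τ k := by
    by_cases hjk : j = k
    · rw [hjk]
    obtain ⟨e, hj, hk⟩ := exists_common_source hjk
    have h1 : κ e = ringWord j (τ j) ⟨e, hj⟩ := congrFun (hτ j) ⟨e, hj⟩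
    have h2 : κ e = ringWord j (τ k) ⟨e, hj⟩ := congrFun (hτ k) ⟨e, hk⟩
    exact ringWord_apply_injective j ⟨e, hj⟩ (h1.symm.trans h2)
  refine ⟨τ ⟨0, by omega⟩, funext fun e => ?_⟩
  have := congrFun (hτ e.1.1) ⟨e, Or.inl rfl⟩
  rw [hc e.1.1 ⟨0, by omega⟩] at this
  exact this

end CompleteNetworkGeometry

/-! ### Interference of the two ring colorings, and the Color-Matching property. -/

section AmbiguousOutputs

variable {n : ℕ}

theorem ambiguousVector_apply (ω : Fin n → Fin 2 → Fin 2 → ℂ) (j : Fin n) (r : Fin 2)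
    (x : (completeNetwork n).SourcesOf j → Fin 2) :
    ambiguousVector ω j r x = ∑ t, if x = ringWord j t then ω j r t else 0 := by
  simp [ambiguousVector, PiLp.single_apply, Fin.sum_univ_two]

theorem ambiguousVector_ringWord (hn : 1 < n) (ω : Fin n → Fin 2 → Fin 2 → ℂ) (j : Fin n)
    (r t : Fin 2) : ambiguousVector ω j r (ringWord j t) = ω j r t := by
  simp [ambiguousVector_apply, (ringWord_injective hn j).eq_iff]

/-- An ambiguous vector is supported on the two ring words, so only the two ring colorings survive
in the sum. -/
theorem sum_prod_ambiguousVector (hn : 1 < n) (ω : Fin n → Fin 2 → Fin 2 → ℂ) (r : Fin n → Fin 2) :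
    ∑ κ : CompleteSource n → Fin 2, ∏ j, ambiguousVector ω j (r j) (received j κ)
      = ∑ t, ∏ j, ω j (r j) t := by
  have h (κ : CompleteSource n → Fin 2) : ∏ j, ambiguousVector ω j (r j) (received j κ)
      = ∑ t, if κ = ringColoring n t then ∏ j, ω j (r j) t else 0 := by
    by_cases hκ : ∀ j, ∃ t, received j κ = ringWord j t
    · obtain ⟨t, rfl⟩ := eq_ringColoring_of_received hn hκ
      simp [(ringColoring_injective hn).eq_iff, received_ringColoring,
        ambiguousVector_ringWord hn]
    · push Not at hκ
      obtain ⟨j, hj⟩ := hκ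
      rw [Finset.prod_eq_zero (Finset.mem_univ j), eq_comm]
      · refine Finset.sum_eq_zero fun t _ => if_neg ?_
        rintro rfl
        exact hj t (received_ringColoring j t)
      · rw [ambiguousVector_apply]
        exact Finset.sum_eq_zero fun t _ => if_neg (hj t)
  simp only [h]
  rw [Finset.sum_comm]
  simp

theorem completeStrategy_prob_inr (hn : 1 < n) (w : Fin n → Fin 2 → Fin 2 → ℝ)
    (hω : ∀ j, Orthonormal ℂ (ambiguousVector (fun j r t => (w j r t : ℂ)) j)) (r : Fin n → Fin 2) :
    (completeStrategy (fun j r t => (w j r t : ℂ)) hω).prob (fun j => Sum.inr (r j))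
      = (1 / 2) ^ Fintype.card (CompleteSource n) * (∑ t, ∏ j, w j (r j) t) ^ 2 := by
  rw [completeStrategy_prob]
  simp only [ketbra, Matrix.of_apply, completeBasis, Finset.prod_mul_distrib]
  simp only [← Finset.sum_mul, ← Finset.mul_sum, ← star_prod, ← star_sum]
  rw [sum_prod_ambiguousVector hn]
  have h : (∑ t, ∏ j, (w j (r j) t : ℂ)) = ((∑ t, ∏ j, w j (r j) t : ℝ) : ℂ) := by push_cast; rfl
  rw [h, show star ((∑ t, ∏ j, w j (r j) t : ℝ) : ℂ) = ((∑ t, ∏ j, w j (r j) t : ℝ) : ℂ) from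
    Complex.conj_ofReal _, show ((1 / 2 : ℂ)) = ((1 / 2 : ℝ) : ℂ) by norm_num]
  norm_cast
  rw [sq]

/-- The coefficients of the rotated bases `c |01⋯10⟩ - s |10⋯01⟩`, `s |01⋯10⟩ + c |10⋯01⟩`. -/
def rotationCoeff (c s : Fin n → ℝ) (j : Fin n) : Fin 2 → Fin 2 → ℝ :=
  ![![c j, -s j], ![s j, c j]]

theorem orthonormal_rotationCoeff (hn : 1 < n) {c s : Fin n → ℝ} (hcs : ∀ j, c j ^ 2 + s j ^ 2 = 1)
    (j : Fin n) : Orthonormal ℂ (ambiguousVector (fun j r t => (rotationCoeff c s j r t : ℂ)) j) := by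
  have hne : ringWord j 0 ≠ ringWord j 1 := fun h => absurd (ringWord_injective hn j h) (by decide)
  rw [orthonormal_iff_ite]
  intro r r'
  have h1 : ((c j : ℂ)) ^ 2 + (s j : ℂ) ^ 2 = 1 := by exact_mod_cast hcs j
  have : inner ℂ (ambiguousVector (fun j r t => (rotationCoeff c s j r t : ℂ)) j r)
      (ambiguousVector (fun j r t => (rotationCoeff c s j r t : ℂ)) j r')
      = ∑ t, (rotationCoeff c s j r t : ℂ) * (rotationCoeff c s j r' t : ℂ) := by
    simp [ambiguousVector, EuclideanSpace.inner_single_left, hne, hne.symm, Fin.sum_univ_two]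
    ring
  rw [this]
  fin_cases r <;> fin_cases r' <;> simp [rotationCoeff, Fin.sum_univ_two]
  · linear_combination h1
  · ring
  · ring
  · linear_combination h1

/-- The interference of the two ring colorings does not show in the outputs of two parties. -/
theorem sum_completeStrategy_prob_inr_pair (hn : 2 < n) {c s : Fin n → ℝ}
    (hcs : ∀ j, c j ^ 2 + s j ^ 2 = 1)
    (hω : ∀ j, Orthonormal ℂ (ambiguousVector (fun j r t => (rotationCoeff c s j r t : ℂ)) j))
    {j k : Fin n} (hjk : j ≠ k) :
    ∑ r : Fin n → Fin 2, (if r j = 1 ∧ r k = 1 then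
        (completeStrategy (fun j r t => (rotationCoeff c s j r t : ℂ)) hω).prob
          (fun i => Sum.inr (r i)) else 0)
      = (1 / 2) ^ Fintype.card (CompleteSource n) *
        (s j ^ 2 * s k ^ 2 + c j ^ 2 * c k ^ 2) := by
  let g : Fin n → Fin 2 → ℝ := fun i b => if i = j ∨ i = k then (if b = 1 then 1 else 0) else 1
  have hg (r : Fin n → Fin 2) : ∏ i, g i (r i) = if r j = 1 ∧ r k = 1 then 1 else 0 := by
    rw [Fintype.prod_eq_mul j k hjk fun i hi => by simp [g, hi.1, hi.2]]
    by_cases h1 : r j = 1 <;> by_cases h2 : r k = 1 <;> simp [g, h1, h2]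
  have hS (f : Fin n → Fin 2 → ℝ) : ∑ r : Fin n → Fin 2, (∏ i, g i (r i)) * ∏ i, f i (r i)
      = ∏ i, ∑ b, g i b * f i b := by
    rw [Fintype.prod_sum]
    simp only [Finset.prod_mul_distrib]
  have hP (f : Fin n → Fin 2 → ℝ) (hf : ∀ i, i ≠ j → i ≠ k → f i 0 + f i 1 = 1) :
      ∏ i, ∑ b, g i b * f i b = f j 1 * f k 1 := by
    rw [Fintype.prod_eq_mul j k hjk fun i hi => by
      simpa [g, hi.1, hi.2] using hf i hi.1 hi.2]
    simp [g]
  -- The cross term of the square contains, for a third party whose output is summed out, the inner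
  -- product of the two columns of a rotation matrix, which is zero.
  have h0 : ∏ i, ∑ b, g i b * (rotationCoeff c s i b 0 * rotationCoeff c s i b 1) = 0 := by
    obtain ⟨i, hij, hik⟩ : ∃ i, i ≠ j ∧ i ≠ k := by
      obtain ⟨i, hi⟩ := Finset.exists_mem_notMem_of_card_lt_card
        (s := {j, k}) (t := (Finset.univ : Finset (Fin n)))
        (lt_of_le_of_lt Finset.card_le_two (by simpa using hn))
      exact ⟨i, by simpa using hi⟩
    refine Finset.prod_eq_zero (Finset.mem_univ i) ?_
    simp [g, hij, hik, Fin.sum_univ_two, rotationCoeff]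
    ring
  have expand (r : Fin n → Fin 2) : (if r j = 1 ∧ r k = 1 then
        (completeStrategy (fun j r t => (rotationCoeff c s j r t : ℂ)) hω).prob
          (fun i => Sum.inr (r i)) else 0)
      = (1 / 2) ^ Fintype.card (CompleteSource n) *
        ((∏ i, g i (r i)) * ∏ i, rotationCoeff c s i (r i) 0 ^ 2 +
          (∏ i, g i (r i)) * ∏ i, rotationCoeff c s i (r i) 1 ^ 2 +
          2 * ((∏ i, g i (r i)) * ∏ i, rotationCoeff c s i (r i) 0 * rotationCoeff c s i (r i) 1)) := by
    rw [completeStrategy_prob_inr (by omega), hg, Fin.sum_univ_two, Finset.prod_pow,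
      Finset.prod_pow, Finset.prod_mul_distrib]
    split_ifs <;> ring
  simp only [expand]
  rw [← Finset.mul_sum, Finset.sum_add_distrib, Finset.sum_add_distrib, ← Finset.mul_sum,
    hS (fun i b => rotationCoeff c s i b 0 ^ 2), hS (fun i b => rotationCoeff c s i b 1 ^ 2),
    hS (fun i b => rotationCoeff c s i b 0 * rotationCoeff c s i b 1), h0,
    hP (fun i b => rotationCoeff c s i b 0 ^ 2) fun i _ _ => by simpa [rotationCoeff] using hcs i,
    hP (fun i b => rotationCoeff c s i b 1 ^ 2) fun i _ _ => by
      simpa [rotationCoeff, add_comm] using hcs i]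
  simp [rotationCoeff]

theorem completeStrategy_isColorMatching (hn : 3 < n) (ω : Fin n → Fin 2 → Fin 2 → ℂ)
    (hω : ∀ j, Orthonormal ℂ (ambiguousVector ω j)) :
    (completeStrategy ω hω).IsColorMatching 2 (fun _ => 1 / 2) := by
  have state_apply (e) (x : (completeNetwork n).PartiesOf e → Fin 2) :
      (completeStrategy ω hω).state e x
        = ∑ b : Fin 2, if x = fun _ => b then ((1 / Real.sqrt 2 : ℝ) : ℂ) else 0 := ghz_apply x
  have h2 (e) (x : (completeNetwork n).PartiesOf e → Fin 2)
      (hx : (completeStrategy ω hω).state e x ≠ 0) : ∃ c, ∀ j, x j = c := by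
    rw [state_apply] at hx
    obtain ⟨b, -, hb⟩ := Finset.exists_ne_zero_of_sum_ne_zero hx
    exact ⟨b, fun j => congrFun (of_not_not fun h => hb (if_neg h)) j⟩
  have h3 (e) (c : Fin 2) : ∑ x : (completeNetwork n).PartiesOf e → Fin 2 with ∀ j, x j = c,
      ‖(completeStrategy ω hω).state e x‖ ^ 2 = 1 / 2 := by
    have hc (b : Fin 2) : ((fun _ => c) : (completeNetwork n).PartiesOf e → Fin 2) = (fun _ => b)
        ↔ c = b := ⟨fun h => congrFun h ⟨e.1.1, Or.inl rfl⟩, fun h => by rw [h]⟩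
    rw [Finset.sum_eq_single fun _ => c]
    · rw [state_apply e fun _ => c]
      simp only [hc, Finset.sum_ite_eq, Finset.mem_univ, if_true, Complex.norm_real,
        Real.norm_eq_abs, sq_abs]
      rw [div_pow, Real.sq_sqrt (by norm_num), one_pow]
    · intro x hx hne
      exact absurd (funext (Finset.mem_filter.1 hx).2) hne
    · intro h
      exact absurd (Finset.mem_filter.2 ⟨Finset.mem_univ _, fun _ => rfl⟩) h
  have h4 (j : Fin n) (c : Fin 2) : ketbra (EuclideanSpace.single (fun _ => c) 1) =
      Matrix.diagonal fun x : (completeNetwork n).SourcesOf j → Fin 2 =>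
        if ∀ i, x i = c then (1 : ℂ) else 0 := by
    have hc (x : (completeNetwork n).SourcesOf j → Fin 2) : (∀ i, x i = c) ↔ x = fun _ => c :=
      funext_iff.symm
    ext x y
    simp only [ketbra, Matrix.of_apply, PiLp.single_apply, Matrix.diagonal_apply, hc]
    by_cases hx : x = fun _ => c <;> by_cases hy : y = fun _ => c <;> simp_all [eq_comm]
  refine ⟨fun _ _ x => x, fun j c => Sum.inl (constOutput hn c j), fun j c c' h => ?_, h2, h3, h4⟩
  obtain ⟨e, he, -⟩ := exists_isBoundary (by omega) j
  exact congrFun (Subtype.ext_iff.1 (Sum.inl_injective h)) ⟨e, he⟩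

end AmbiguousOutputs

/-! ### Marginals of a product of response functions. -/

section Marginals

variable {J : Type} [Fintype J] [DecidableEq J] {O : J → Type} [∀ j, Fintype (O j)]
  [∀ j, DecidableEq (O j)]

theorem sum_ite_prod_single (f : ∀ j, O j → ℝ) (j : J) (a : O j)
    (hf : ∀ k ≠ j, ∑ b, f k b = 1) :
    ∑ o : ∀ k, O k, (if o j = a then ∏ k, f k (o k) else 0) = f j a := by
  let h : ∀ k, O k → ℝ := fun k o => if hk : k = j then if hk ▸ o = a then 1 else 0 else 1
  have hk1 (k) (o : O k) (h1 : k ≠ j) : h k o = 1 := by simp [h, h1]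
  have hkj (o : O j) : h j o = if o = a then 1 else 0 := by simp [h]
  have lhs (o : ∀ k, O k) : (if o j = a then ∏ k, f k (o k) else 0)
      = ∏ k, h k (o k) * f k (o k) := by
    rw [Finset.prod_mul_distrib, Fintype.prod_eq_single j fun k h1 => hk1 k _ h1, hkj, ite_mul,
      one_mul, zero_mul]
  simp only [lhs]
  rw [← Fintype.prod_sum fun k o => h k o * f k o, Fintype.prod_eq_single j]
  · simp [hkj]
  · intro k hk
    simp only [hk1 k _ hk, one_mul, hf k hk]

theorem sum_ite_prod_pair (f : ∀ j, O j → ℝ) {j j' : J} (hj : j ≠ j') (a : O j) (a' : O j')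
    (hf : ∀ k, k ≠ j → k ≠ j' → ∑ b, f k b = 1) :
    ∑ o : ∀ k, O k, (if o j = a ∧ o j' = a' then ∏ k, f k (o k) else 0) = f j a * f j' a' := by
  let h : ∀ k, O k → ℝ := fun k o => if hk : k = j' then if hk ▸ o = a' then f k o else 0 else f k o
  have hk1 (k) (o : O k) (h1 : k ≠ j') : h k o = f k o := by simp [h, h1]
  have hkj (o : O j') : h j' o = if o = a' then f j' o else 0 := by simp [h]
  have lhs (o : ∀ k, O k) : (∏ k, h k (o k))
      = if o j' = a' then ∏ k, f k (o k) else 0 := by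
    rw [← Finset.mul_prod_erase Finset.univ (fun k => h k (o k)) (Finset.mem_univ j'),
      ← Finset.mul_prod_erase Finset.univ (fun k => f k (o k)) (Finset.mem_univ j'), hkj, ite_mul,
      zero_mul, Finset.prod_congr rfl fun k hk => hk1 k _ (Finset.ne_of_mem_erase hk)]
  have e (o : ∀ k, O k) : (if o j = a ∧ o j' = a' then ∏ k, f k (o k) else 0)
      = if o j = a then ∏ k, h k (o k) else 0 := by rw [ite_and, lhs]
  let s : ℝ := f j' a'
  have hs : ∑ b, h j' b = s := by simp [hkj, s]
  -- The one-party formula needs the weights at `j'` to sum to `1`, so the weights cut down to `a'`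
  -- are divided by their sum `s`.
  by_cases hs0 : s = 0
  · rw [show f j' a' = 0 from hs0, mul_zero]
    refine Finset.sum_eq_zero fun o _ => ?_
    split_ifs with ho
    · exact Finset.prod_eq_zero (Finset.mem_univ j') (by rw [ho.2]; exact hs0)
    · rfl
  · let g : ∀ k, O k → ℝ := fun k o => if k = j' then s⁻¹ * h k o else h k o
    have := sum_ite_prod_single g j a (by
      intro k hk
      by_cases hk' : k = j'
      · subst hk'
        simp only [g, if_true, ← Finset.mul_sum, hs, inv_mul_cancel₀ hs0]
      · simp only [g, hk', if_false, hk1 k _ hk', hf k hk hk'])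
    have hg (o : ∀ k, O k) : ∏ k, h k (o k) = s * ∏ k, g k (o k) := by
      rw [← Finset.mul_prod_erase Finset.univ (fun k => h k (o k)) (Finset.mem_univ j'),
        ← Finset.mul_prod_erase Finset.univ (fun k => g k (o k)) (Finset.mem_univ j'),
        Finset.prod_congr rfl fun k hk => if_neg (Finset.ne_of_mem_erase hk)]
      simp only [g, if_true]
      field_simp
    have hgj : g j a = f j a := by simp only [g, hj, if_false, hk1 j _ hj]
    simp only [e, hg, ← mul_ite_zero, ← Finset.mul_sum]
    rw [this, hgj, mul_comm]

end Marginals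

/-! ### Responses of a classical strategy and fair colorings of its sources. -/

section Responses

variable {n : ℕ} (c : ClassicalStrategy.{u} (completeNetwork n) (CompleteOutput n))

instance (e : CompleteSource n) : MeasurableSpace (c.S e) := c.measurableSpace e

/-- The law of the values of all sources. -/
noncomputable abbrev ClassicalStrategy.joint : Measure (∀ e, c.S e) :=
  Measure.pi fun e => (c.law e : Measure (c.S e))

/-- The response of the party `j` as a function of the values of all sources. -/
def ClassicalStrategy.answer (j : Fin n) (a : CompleteOutput n j) (s : ∀ e, c.S e) : ℝ :=
  c.response j (received j s) a

/-- The sources connected to the party `j`. -/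
def sources (j : Fin n) : Finset (CompleteSource n) :=
  Finset.univ.filter fun e => (completeNetwork n).Conn e j

theorem mem_sources {j : Fin n} {e : CompleteSource n} :
    e ∈ sources j ↔ (completeNetwork n).Conn e j := by
  simp [sources]

theorem sources_inter_subset {j k : Fin n} (h : j ≠ k) {e : CompleteSource n}
    (hj : (completeNetwork n).Conn e j) (hk : (completeNetwork n).Conn e k) :
    sources j ∩ sources k ⊆ {e} := by
  intro e' he'
  rw [Finset.mem_inter, mem_sources, mem_sources] at he'
  exact Finset.mem_singleton.2 (common_source_unique h he'.1 he'.2 hj hk)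

theorem disjoint_sources_erase {j k : Fin n} (h : j ≠ k) {e : CompleteSource n}
    (hj : (completeNetwork n).Conn e j) (hk : (completeNetwork n).Conn e k) :
    Disjoint (sources j) ((sources k).erase e) := by
  rw [Finset.disjoint_left]
  intro e' h1 h2
  exact Finset.ne_of_mem_erase h2 (Finset.mem_singleton.1
    (sources_inter_subset h hj hk (Finset.mem_inter.2 ⟨h1, Finset.mem_of_mem_erase h2⟩)))

namespace ClassicalStrategy

theorem measurable_answer (j : Fin n) (a) : Measurable (c.answer j a) :=
  (c.measurable_response j a).comp (measurable_pi_lambda _ fun e => measurable_pi_apply e.1)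

theorem sum_answer (j : Fin n) (s) : ∑ a, c.answer j a s = 1 := c.response_sum j _

theorem answer_mem (j : Fin n) (a) (s) : c.answer j a s ∈ Set.Icc (0 : ℝ) 1 := by
  refine ⟨c.response_nonneg j _ a, ?_⟩
  rw [← c.sum_answer j s]
  exact Finset.single_le_sum (f := fun a => c.answer j a s)
    (fun b _ => c.response_nonneg j _ b) (Finset.mem_univ a)

theorem dependsOn_answer (j : Fin n) (a) :
    DependsOn (c.answer j a) (sources j : Set (CompleteSource n)) := by
  intro s t h
  unfold answer
  congr 1
  exact funext fun e => h e.1 (mem_sources.2 e.2)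

theorem integrable_of_mem {f : (∀ e, c.S e) → ℝ} (hf : Measurable f)
    (h : ∀ s, f s ∈ Set.Icc (0 : ℝ) 1) : Integrable f c.joint :=
  Integrable.of_mem_Icc 0 1 hf.aemeasurable (Filter.Eventually.of_forall h)

theorem prod_answer_mem (o : ∀ j, CompleteOutput n j) (s) :
    ∏ j, c.answer j (o j) s ∈ Set.Icc (0 : ℝ) 1 :=
  ⟨Finset.prod_nonneg fun j _ => (c.answer_mem j _ s).1,
    Finset.prod_le_one (fun j _ => (c.answer_mem j _ s).1) fun j _ => (c.answer_mem j _ s).2⟩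

theorem integrable_prod_answer (o : ∀ j, CompleteOutput n j) :
    Integrable (fun s => ∏ j, c.answer j (o j) s) c.joint :=
  c.integrable_of_mem (Finset.measurable_fun_prod _ fun j _ => c.measurable_answer j _)
    (c.prod_answer_mem o)

theorem sum_prob_single (j : Fin n) (a : CompleteOutput n j) :
    ∑ o : ∀ k, CompleteOutput n k, (if o j = a then c.prob o else 0)
      = ∫ s, c.answer j a s ∂c.joint := by
  have h (s) := sum_ite_prod_single (fun j a => c.answer j a s) j a fun k _ => c.sum_answer k s
  simp only [← h]
  rw [integral_finsetSum]
  · refine Finset.sum_congr rfl fun o _ => ?_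
    split_ifs
    · rfl
    · simp
  · intro o _
    split_ifs
    · exact c.integrable_prod_answer o
    · exact integrable_zero _ _ _

theorem sum_prob_pair {j j' : Fin n} (hj : j ≠ j') (a : CompleteOutput n j) (a') :
    ∑ o : ∀ k, CompleteOutput n k, (if o j = a ∧ o j' = a' then c.prob o else 0)
      = ∫ s, c.answer j a s * c.answer j' a' s ∂c.joint := by
  have h (s) := sum_ite_prod_pair (fun j a => c.answer j a s) hj a a' fun k _ _ => c.sum_answer k s
  simp only [← h]
  rw [integral_finsetSum]
  · refine Finset.sum_congr rfl fun o _ => ?_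
    split_ifs
    · rfl
    · simp
  · intro o _
    split_ifs
    · exact c.integrable_prod_answer o
    · exact integrable_zero _ _ _

/-- The indicator of the event that the sources in `T` have the colors `κ`. -/
def box (χ : ∀ e, c.S e → Fin 2) (κ : CompleteSource n → Fin 2) (T : Finset (CompleteSource n))
    (s : ∀ e, c.S e) : ℝ :=
  ∏ e ∈ T, if χ e (s e) = κ e then 1 else 0

variable {c} {χ : ∀ e, c.S e → Fin 2} (κ : CompleteSource n → Fin 2)
  (T : Finset (CompleteSource n))

theorem box_eq (s) : c.box χ κ T s = if ∀ e ∈ T, χ e (s e) = κ e then 1 else 0 := by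
  rw [box, Finset.prod_boole]
  congr

theorem box_mem (s) : c.box χ κ T s ∈ Set.Icc (0 : ℝ) 1 := by
  rw [box_eq]
  split_ifs <;> simp

theorem measurable_box (hχ : ∀ e, Measurable (χ e)) : Measurable (c.box χ κ T) := by
  refine Finset.measurable_fun_prod _ fun e _ => Measurable.ite ?_ measurable_const measurable_const
  exact (hχ e).comp (measurable_pi_apply e) (measurableSet_singleton _)

theorem dependsOn_box : DependsOn (c.box χ κ T) (T : Set (CompleteSource n)) := by
  intro s t h
  exact Finset.prod_congr rfl fun e he => by rw [h e he]

theorem integral_box_eq_prod (hχ : ∀ e, Measurable (χ e)) :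
    ∫ s, c.box χ κ T s ∂c.joint = ∏ e ∈ T, (c.law e : Measure (c.S e)).real {v | χ e v = κ e} := by
  have h (s) : c.box χ κ T s
      = ∏ e, (if e ∈ T then {v | χ e v = κ e}.indicator 1 else 1 : c.S e → ℝ) (s e) := by
    rw [box, ← Finset.prod_subset (Finset.subset_univ T)]
    · exact Finset.prod_congr rfl fun e he => by simp [he, Set.indicator_apply]
    · intro e _ he
      simp [he]
  simp only [h]
  rw [integral_fintype_prod_eq_prod, ← Finset.prod_subset (Finset.subset_univ T)]
  · refine Finset.prod_congr rfl fun e he => ?_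
    simp only [he, if_true]
    exact integral_indicator_one (hχ e (measurableSet_singleton _))
  · intro e _ he
    simp [he]

/-- Every source has each of the two colors with probability `1 / 2`. -/
structure IsFairColoring (χ : ∀ e, c.S e → Fin 2) : Prop where
  measurable : ∀ e, Measurable (χ e)
  fair : ∀ e b, (c.law e : Measure (c.S e)).real {v | χ e v = b} = 1 / 2

theorem IsFairColoring.integral_box (hχ : IsFairColoring χ) : ∫ s, c.box χ κ T s ∂c.joint = (1 / 2) ^ T.card := by
  rw [integral_box_eq_prod κ T hχ.measurable, Finset.prod_congr rfl fun e _ => hχ.fair e (κ e),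
    Finset.prod_const]

/-- Independent fair colors are uniform over all colorings, exactly as in the quantum formulas; this
identity carries quantum marginals over to classical integrals. -/
theorem IsFairColoring.integral_comp (hχ : IsFairColoring χ) (g : (CompleteSource n → Fin 2) → ℝ) :
    ∫ s, g (fun e => χ e (s e)) ∂c.joint
      = (1 / 2) ^ Fintype.card (CompleteSource n) * ∑ κ, g κ := by
  have h (s : ∀ e, c.S e) : g (fun e => χ e (s e)) = ∑ κ, c.box χ κ Finset.univ s * g κ := by
    rw [Finset.sum_eq_single fun e => χ e (s e)]
    · simp [box_eq]
    · intro κ _ hκ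
      have : ¬ ∀ e, χ e (s e) = κ e := fun h => hκ (funext h).symm
      rw [box_eq, if_neg (by simpa only [Finset.mem_univ, true_imp_iff] using this), zero_mul]
    · simp
  simp only [h]
  rw [integral_finsetSum, Finset.mul_sum]
  · refine Finset.sum_congr rfl fun κ _ => ?_
    rw [integral_mul_const, hχ.integral_box, Finset.card_univ]
  · intro κ _
    exact (integrable_of_mem c (measurable_box κ _ hχ.measurable) (box_mem κ _)).mul_const _

/-- Restricting to colors of sources that do not matter for `f` is harmless. -/
theorem IsFairColoring.ae_eq_zero (hχ : IsFairColoring χ) {S : Finset (CompleteSource n)} (hST : Disjoint S T)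
    {f : (∀ e, c.S e) → ℝ} (hf : Measurable f) (hf0 : ∀ s, f s ∈ Set.Icc (0 : ℝ) 1)
    (hfS : DependsOn f (S : Set (CompleteSource n)))
    (h : ∫ s, f s * c.box χ κ T s ∂c.joint = 0) : f =ᵐ[c.joint] 0 := by
  rw [integral_mul_of_dependsOn_disjoint _ hST hf (measurable_box κ T hχ.measurable) hfS
    (dependsOn_box κ T), hχ.integral_box] at h
  have h' := (mul_eq_zero.1 h).resolve_right (by positivity)
  exact (integral_eq_zero_iff_of_nonneg (fun s => (hf0 s).1) (c.integrable_of_mem hf hf0)).1 h'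

end ClassicalStrategy

end Responses

/-! ### Rigidity: classical sources carry colors, and unambiguous outputs report them. -/

section Rigidity

/-- Multiplying the two bounds gives `(1 / 4) ^ card E ≤ ∏ e, p e * (1 - p e)`, while each factor is
at most `1 / 4`, with equality only at `1 / 2`. -/
theorem eq_half_of_half_pow_le_prod {E : Type} [Fintype E] {p : E → ℝ}
    (h0 : ∀ e, p e ∈ Set.Icc (0 : ℝ) 1) (h1 : (1 / 2) ^ Fintype.card E ≤ ∏ e, p e)
    (h2 : (1 / 2) ^ Fintype.card E ≤ ∏ e, (1 - p e)) (e : E) : p e = 1 / 2 := by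
  by_contra he
  have hpos : (0 : ℝ) < (1 / 2) ^ Fintype.card E := by positivity
  have pos {q : E → ℝ} (hq : ∀ e, 0 ≤ q e) (h : (1 / 2) ^ Fintype.card E ≤ ∏ e, q e) (e) :
      0 < q e := by
    refine lt_of_le_of_ne (hq e) fun h' => ?_
    rw [Finset.prod_eq_zero (Finset.mem_univ e) h'.symm] at h
    exact absurd h (not_le.2 hpos)
  have hlt : ∏ e, p e * (1 - p e) < ∏ _e : E, (1 / 4 : ℝ) := by
    refine Finset.prod_lt_prod (fun e _ => mul_pos (pos (fun e => (h0 e).1) h1 e)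
      (pos (fun e => sub_nonneg.2 (h0 e).2) h2 e)) (fun e _ => ?_) ⟨e, Finset.mem_univ e, ?_⟩
    · nlinarith [sq_nonneg (p e - 1 / 2)]
    · have : 0 < (p e - 1 / 2) ^ 2 := by
        have := sub_ne_zero.2 he
        positivity
      nlinarith
  rw [Finset.prod_mul_distrib, Finset.prod_const, Finset.card_univ] at hlt
  have := mul_le_mul h1 h2 hpos.le (hpos.le.trans h1)
  rw [← mul_pow] at this
  norm_num at this hlt
  linarith

namespace ClassicalStrategy

variable {n : ℕ} {c : ClassicalStrategy.{u} (completeNetwork n) (CompleteOutput n)}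
  {ω : Fin n → Fin 2 → Fin 2 → ℂ} {hω : ∀ j, Orthonormal ℂ (ambiguousVector ω j)}

theorem integral_answer (hP : ∀ a, c.prob a = (completeStrategy ω hω).prob a) (j : Fin n)
    (a : CompleteOutput n j) :
    ∫ s, c.answer j a s ∂c.joint
      = (1 / 2) ^ Fintype.card (CompleteSource n) * ∑ κ : CompleteSource n → Fin 2,
        ‖completeBasis ω j a (received j κ)‖ ^ 2 := by
  rw [← sum_prob_single, ← sum_completeStrategy_prob_single ω hω]
  simp only [hP]

theorem integral_answer_mul_answer (hP : ∀ a, c.prob a = (completeStrategy ω hω).prob a)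
    {j j' : Fin n} (hj : j ≠ j') (a : CompleteOutput n j) (b) :
    ∫ s, c.answer j a s * c.answer j' (Sum.inl b) s ∂c.joint
      = (1 / 2) ^ Fintype.card (CompleteSource n) * ∑ κ : CompleteSource n → Fin 2,
        if received j' κ = b.1 then ‖completeBasis ω j a (received j κ)‖ ^ 2 else 0 := by
  rw [← sum_prob_pair c hj, ← sum_completeStrategy_prob_pair ω hω hj]
  simp only [hP]

/-- Words that disagree on a common source are never output together. -/
theorem integral_answer_mul_answer_eq_zero (hP : ∀ a, c.prob a = (completeStrategy ω hω).prob a)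
    {j j' : Fin n} (hj : j ≠ j') {e : CompleteSource n} (he : (completeNetwork n).Conn e j)
    (he' : (completeNetwork n).Conn e j') (x) (y)
    (hxy : x.1 ⟨e, he⟩ ≠ y.1 ⟨e, he'⟩) :
    ∫ s, c.answer j (Sum.inl x) s * c.answer j' (Sum.inl y) s ∂c.joint = 0 := by
  rw [integral_answer_mul_answer hP hj]
  refine mul_eq_zero_of_right _ (Finset.sum_eq_zero fun κ _ => ?_)
  rw [norm_completeBasis_inl_sq]
  split_ifs with h1 h2
  · exact absurd ((congrFun h2 ⟨e, he⟩).symm.trans (congrFun h1 ⟨e, he'⟩)) hxy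
  · rfl
  · rfl

/-- The sources of a classical strategy with the same distribution are colored. -/
theorem exists_fair_coloring (hn : 3 < n)
    (hP : ∀ a, c.prob a = (completeStrategy ω hω).prob a) :
    ∃ χ : ∀ e, c.S e → Fin 2, IsFairColoring χ ∧
      ∀ b, (fun s => ∏ j, c.answer j (Sum.inl (constOutput hn b j)) s) =ᵐ[c.joint]
        c.box χ (fun _ => b) Finset.univ := by
  classical
  have h01 : ∀ b : Fin 2, b = 0 ∨ b = 1 := by decide
  have hsep (e : CompleteSource n) := exists_separating_set
    (fun e => (c.law e : Measure (c.S e)))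
    (sources_inter_subset e.2.ne (e := e) (Or.inl rfl) (Or.inr rfl))
    (c.measurable_answer e.1.1 (Sum.inl (constOutput hn 0 _)))
    (c.measurable_answer e.1.2 (Sum.inl (constOutput hn 1 _)))
    (c.answer_mem _ _) (c.answer_mem _ _) (c.dependsOn_answer _ _) (c.dependsOn_answer _ _)
    (integral_answer_mul_answer_eq_zero hP e.2.ne (e := e) (Or.inl rfl) (Or.inr rfl) _ _
      (by decide : (0 : Fin 2) ≠ 1))
  choose A hA hA0 hA1 using hsep
  let χ : ∀ e, c.S e → Fin 2 := fun e v => if v ∈ A e then 0 else 1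
  have hχm (e) : Measurable (χ e) := Measurable.ite (hA e) measurable_const measurable_const
  have hχ0 (e) (v) : χ e v = 0 ↔ v ∈ A e := by simp [χ]
  have hχ1 (e) (v) : χ e v = 1 ↔ v ∉ A e := by simp [χ]
  -- A source of the wrong color silences one of its two ends: the first if `b = 0`, the second if
  -- `b = 1`, because these were the outputs separated by `A e`.
  have hle (b : Fin 2) : (fun s => ∏ j, c.answer j (Sum.inl (constOutput hn b j)) s) ≤ᵐ[c.joint]
      c.box χ (fun _ => b) Finset.univ := by
    filter_upwards [ae_all_iff.2 hA0, ae_all_iff.2 hA1] with s h0 h1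
    rw [box_eq]
    split_ifs with h
    · exact (c.prod_answer_mem _ s).2
    · push Not at h
      obtain ⟨e, -, he⟩ := h
      obtain rfl | rfl := h01 b
      · exact (Finset.prod_eq_zero (Finset.mem_univ e.1.1) (h0 e (mt (hχ0 _ _).2 he))).le
      · exact (Finset.prod_eq_zero (Finset.mem_univ e.1.2)
          (h1 e (of_not_not (mt (hχ1 _ _).2 he)))).le
  have hint (b : Fin 2) : ∫ s, ∏ j, c.answer j (Sum.inl (constOutput hn b j)) s ∂c.joint
      = (1 / 2) ^ Fintype.card (CompleteSource n) := by
    refine (hP fun j => Sum.inl (constOutput hn b j)).trans ?_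
    rw [completeStrategy_prob_inl, Finset.sum_eq_single fun _ => b]
    · have h (j) : received j (fun _ => b) = (constOutput hn b j).1 := rfl
      rw [if_pos h, mul_one]
    · intro κ _ hκ
      refine if_neg fun h => hκ (funext fun e => ?_)
      exact congrFun (h e.1.1) ⟨e, Or.inl rfl⟩
    · simp
  have hbox (b : Fin 2) : (1 / 2) ^ Fintype.card (CompleteSource n)
      ≤ ∏ e, (c.law e : Measure (c.S e)).real {v | χ e v = b} := by
    rw [← hint b, ← integral_box_eq_prod (fun _ => b) Finset.univ hχm]
    exact integral_mono_ae (c.integrable_prod_answer _)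
      (c.integrable_of_mem (measurable_box _ _ hχm) (box_mem _ _)) (hle b)
  have hcompl (e) : (c.law e : Measure (c.S e)).real {v | χ e v = 1}
      = 1 - (c.law e : Measure (c.S e)).real {v | χ e v = 0} := by
    rw [← probReal_compl_eq_one_sub (s := {v | χ e v = 0}) (hχm e (measurableSet_singleton 0))]
    congr 1
    ext v
    simp [hχ0, hχ1]
  have hhalf (e) : (c.law e : Measure (c.S e)).real {v | χ e v = 0} = 1 / 2 :=
    eq_half_of_half_pow_le_prod (fun e => ⟨measureReal_nonneg, measureReal_le_one⟩) (hbox 0)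
      (by simpa only [hcompl] using hbox 1) e
  have hχ : IsFairColoring χ := by
    refine ⟨hχm, fun e b => ?_⟩
    obtain rfl | rfl := h01 b
    · exact hhalf e
    · rw [hcompl, hhalf]
      norm_num
  refine ⟨χ, hχ, fun b => ?_⟩
  refine (integral_eq_iff_of_ae_le (c.integrable_prod_answer _)
    (c.integrable_of_mem (measurable_box _ _ hχm) (box_mem _ _)) (hle b)).1 ?_
  rw [hint, hχ.integral_box, Finset.card_univ]

theorem box_union {χ : ∀ e, c.S e → Fin 2} (κ : CompleteSource n → Fin 2)
    {S T : Finset (CompleteSource n)} (h : Disjoint S T) (s) :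
    c.box χ κ (S ∪ T) s = c.box χ κ S s * c.box χ κ T s :=
  Finset.prod_union h

theorem box_sources (χ : ∀ e, c.S e → Fin 2) (κ : CompleteSource n → Fin 2) (j : Fin n) (s) :
    c.box χ κ (sources j) s
      = if received j (fun e => χ e (s e)) = received j κ then 1 else 0 := by
  rw [box_eq]
  refine if_congr ⟨fun h => funext fun e => h e.1 (mem_sources.2 e.2), fun h e he => ?_⟩ rfl rfl
  exact congrFun h ⟨e, mem_sources.1 he⟩

/-- A word is output with the probability with which it is received. -/
theorem integral_answer_inl {χ : ∀ e, c.S e → Fin 2} (hχ : IsFairColoring χ)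
    (hP : ∀ a, c.prob a = (completeStrategy ω hω).prob a) (j : Fin n) (x) :
    ∫ s, c.answer j (Sum.inl x) s ∂c.joint
      = ∫ s, (if received j (fun e => χ e (s e)) = x.1 then 1 else 0 : ℝ) ∂c.joint := by
  rw [hχ.integral_comp fun κ => if received j κ = x.1 then 1 else 0, integral_answer hP]
  simp only [norm_completeBasis_inl_sq]

theorem measurable_received_indicator {χ : ∀ e, c.S e → Fin 2} (hχ : IsFairColoring χ) (j : Fin n)
    (x : (completeNetwork n).SourcesOf j → Fin 2) :
    Measurable fun s : ∀ e, c.S e =>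
      (if received j (fun e => χ e (s e)) = x then 1 else 0 : ℝ) := by
  refine Measurable.ite ?_ measurable_const measurable_const
  have : Measurable fun s : ∀ e, c.S e => received j (fun e => χ e (s e)) :=
    measurable_pi_lambda _ fun e => (hχ.measurable e.1).comp (measurable_pi_apply e.1)
  exact this (measurableSet_singleton x)

theorem received_indicator_mem {χ : ∀ e, c.S e → Fin 2} (j : Fin n)
    (x : (completeNetwork n).SourcesOf j → Fin 2) (s : ∀ e, c.S e) :
    (if received j (fun e => χ e (s e)) = x then 1 else 0 : ℝ) ∈ Set.Icc (0 : ℝ) 1 := by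
  split_ifs <;> simp

/-- If all sources have color `b`, every party outputs the constant word. The response of `j`
ignores the sources not connected to it, and by independence these have color `b` with positive
probability, so the conclusion for `j` needs only its own sources. Equality then follows by
comparing integrals. -/
theorem answer_const_ae_eq (hn : 3 < n) {χ : ∀ e, c.S e → Fin 2} (hχ : IsFairColoring χ)
    (hP : ∀ a, c.prob a = (completeStrategy ω hω).prob a) (b : Fin 2)
    (hb : (fun s => ∏ j, c.answer j (Sum.inl (constOutput hn b j)) s) =ᵐ[c.joint]
        c.box χ (fun _ => b) Finset.univ) (j : Fin n) :
    c.answer j (Sum.inl (constOutput hn b j)) =ᵐ[c.joint]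
      c.box χ (fun _ => b) (sources j) := by
  set F := c.answer j (Sum.inl (constOutput hn b j))
  let f : (∀ e, c.S e) → ℝ := fun s => (1 - F s) * c.box χ (fun _ => b) (sources j) s
  have hf0 (s) : f s ∈ Set.Icc (0 : ℝ) 1 := by
    have h1 := c.answer_mem j (Sum.inl (constOutput hn b j)) s
    have h2 := box_mem (c := c) (χ := χ) (fun _ => b) (sources j) s
    exact ⟨mul_nonneg (sub_nonneg.2 h1.2) h2.1,
      mul_le_one₀ (sub_le_self _ h1.1) h2.1 h2.2⟩
  have hf : f =ᵐ[c.joint] 0 := by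
    refine hχ.ae_eq_zero (fun _ => b) (sources j)ᶜ (S := sources j) disjoint_compl_right
      ((measurable_const.sub (c.measurable_answer j _)).mul (measurable_box _ _ hχ.measurable)) hf0
      (fun s t h => ?_) (integral_eq_zero_of_ae ?_)
    · simp only [f, F, c.dependsOn_answer j _ h, dependsOn_box (c := c) (χ := χ) _ _ h]
    · filter_upwards [hb] with s hs
      simp only [f, Pi.zero_apply]
      rw [mul_assoc, ← box_union _ disjoint_compl_right, Finset.union_compl, ← hs]
      by_cases h1 : F s = 1
      · rw [h1, sub_self, zero_mul]
      · rw [hs, box_eq]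
        rw [box_eq] at hs
        split_ifs at hs ⊢ with h
        · refine absurd ?_ h1
          refine le_antisymm (c.answer_mem j _ s).2 (hs ▸ ?_)
          rw [← Finset.mul_prod_erase _ _ (Finset.mem_univ j)]
          exact mul_le_of_le_one_right (c.answer_mem j _ s).1
            (Finset.prod_le_one (fun k _ => (c.answer_mem k _ s).1)
              fun k _ => (c.answer_mem k _ s).2)
        · rw [mul_zero]
  refine ((integral_eq_iff_of_ae_le (c.integrable_of_mem (measurable_box _ _ hχ.measurable)
    (box_mem _ _)) (c.integrable_of_mem (c.measurable_answer j _) (c.answer_mem j _)) ?_).1 ?_).symm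
  · filter_upwards [hf] with s hs
    rcases mul_eq_zero.1 hs with h | h
    · exact (box_mem _ _ s).2.trans (sub_eq_zero.1 h).le
    · rw [h]
      exact (c.answer_mem j _ s).1
  · rw [integral_answer_inl hχ hP]
    simp only [box_sources]
    rfl

/-- In a classical strategy with the same distribution, the party `j` outputs the word of the colors
of her sources. -/
theorem answer_inl_ae_eq {χ : ∀ e, c.S e → Fin 2} (hχ : IsFairColoring χ) (hn : 3 < n)
    (hP : ∀ a, c.prob a = (completeStrategy ω hω).prob a)
    (hb : ∀ b j, c.answer j (Sum.inl (constOutput hn b j)) =ᵐ[c.joint]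
      c.box χ (fun _ => b) (sources j)) (j : Fin n) (x) :
    c.answer j (Sum.inl x) =ᵐ[c.joint]
      fun s => if received j (fun e => χ e (s e)) = x.1 then 1 else 0 := by
  -- When `e` has the color `b` opposite to `x.1 e`, the other end `j'` would output the constant
  -- word `b` if its remaining sources also had color `b`, and that word excludes `x` at `j`. The
  -- remaining sources of `j'` are independent of `j`, so this condition can be dropped.
  have key (e : (completeNetwork n).SourcesOf j) :
      ∀ᵐ s ∂c.joint, χ e.1 (s e.1) ≠ x.1 e → c.answer j (Sum.inl x) s = 0 := by
    obtain ⟨e, he⟩ := e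
    obtain ⟨j', hj', he'⟩ : ∃ j', j ≠ j' ∧ (completeNetwork n).Conn e j' := by
      rcases he with h | h
      · exact ⟨e.1.2, fun h' => e.2.ne (h.trans h'), Or.inr rfl⟩
      · exact ⟨e.1.1, fun h' => e.2.ne (h'.symm.trans h.symm), Or.inl rfl⟩
    let b := 1 - x.1 ⟨e, he⟩
    have hxb : ∀ y z : Fin 2, (y ≠ z → y = 1 - z) ∧ z ≠ 1 - z := by decide
    have h0 := integral_answer_mul_answer_eq_zero hP hj' he he' x (constOutput hn b j')
      (hxb 0 _).2
    have h1 : (fun s => c.answer j (Sum.inl x) s * c.box χ (fun _ => b) {e} s) =ᵐ[c.joint] 0 := by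
      refine hχ.ae_eq_zero (fun _ => b) ((sources j').erase e) (S := sources j)
        (disjoint_sources_erase hj' he he')
        ((c.measurable_answer j _).mul (measurable_box _ _ hχ.measurable))
        (fun s => ⟨mul_nonneg (c.answer_mem j _ s).1 (box_mem _ _ s).1,
          mul_le_one₀ (c.answer_mem j _ s).2 (box_mem _ _ s).1 (box_mem _ _ s).2⟩)
        (fun s t h => ?_) ?_
      · rw [c.dependsOn_answer j _ h, dependsOn_box (c := c) (χ := χ) _ {e} fun e' h' => h e' ?_]
        rw [Finset.mem_singleton.1 h']
        exact mem_sources.2 he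
      · rw [← h0]
        refine integral_congr_ae ?_
        filter_upwards [hb b j'] with s hs
        rw [hs, mul_assoc, ← box_union _ (by simp), ← Finset.insert_eq,
          Finset.insert_erase (mem_sources.2 he')]
    filter_upwards [h1] with s hs hne
    have : c.box χ (fun _ => b) {e} s = 1 := by
      rw [box_eq, if_pos]
      intro e' h'
      rw [Finset.mem_singleton.1 h']
      exact (hxb _ _).1 hne
    simpa [this] using hs
  refine (integral_eq_iff_of_ae_le (c.integrable_of_mem (c.measurable_answer j _)
    (c.answer_mem j _)) (c.integrable_of_mem (measurable_received_indicator hχ j _)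
      (received_indicator_mem j _)) ?_).1 (integral_answer_inl hχ hP j x)
  filter_upwards [ae_all_iff.2 key] with s hs
  by_cases h : received j (fun e => χ e (s e)) = x.1
  · simp only [h, if_true]
    exact (c.answer_mem j _ s).2
  · obtain ⟨e, he⟩ := Function.ne_iff.1 h
    simp only [h, if_false]
    exact (hs e he).le

/-- A classical strategy colors its sources fairly, and the parties output the word of the colors
that they receive, unless it is ambiguous. -/
theorem exists_coloring (hn : 3 < n) (hP : ∀ a, c.prob a = (completeStrategy ω hω).prob a) :
    ∃ χ : ∀ e, c.S e → Fin 2, IsFairColoring χ ∧ ∀ᵐ s ∂c.joint, ∀ j x,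
      c.answer j (Sum.inl x) s = if received j (fun e => χ e (s e)) = x.1 then 1 else 0 := by
  obtain ⟨χ, hχ, h⟩ := exists_fair_coloring hn hP
  exact ⟨χ, hχ, ae_all_iff.2 fun j => ae_all_iff.2 fun x =>
    answer_inl_ae_eq hχ hn hP (fun b j => answer_const_ae_eq hn hχ hP b (h b) j) j x⟩

end ClassicalStrategy

end Rigidity

/-! ### Ambiguous responses and the Hardy-type contradiction. -/

section Nonlocality

namespace ClassicalStrategy

variable {n : ℕ} {c : ClassicalStrategy.{u} (completeNetwork n) (CompleteOutput n)}
  {χ : ∀ e, c.S e → Fin 2}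

theorem answer_inr_eq_zero {s : ∀ e, c.S e} {j : Fin n}
    (h : ∀ x, c.answer j (Sum.inl x) s = if received j (fun e => χ e (s e)) = x.1 then 1 else 0)
    (hs : ∀ t, received j (fun e => χ e (s e)) ≠ ringWord j t) (r : Fin 2) :
    c.answer j (Sum.inr r) s = 0 := by
  have h1 : c.answer j (Sum.inl ⟨_, hs⟩) s = 1 := by rw [h, if_pos rfl]
  have h2 := c.sum_answer j s
  rw [← Finset.add_sum_erase _ _ (Finset.mem_univ (Sum.inl ⟨_, hs⟩)), h1] at h2
  refine (Finset.sum_eq_zero_iff_of_nonneg fun a _ => (c.answer_mem j a s).1).1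
    (add_eq_left.1 h2) _ ?_
  simp

theorem sum_answer_inr {s : ∀ e, c.S e} {j : Fin n} {t : Fin 2}
    (h : ∀ x, c.answer j (Sum.inl x) s = if received j (fun e => χ e (s e)) = x.1 then 1 else 0)
    (hs : received j (fun e => χ e (s e)) = ringWord j t) :
    ∑ r, c.answer j (Sum.inr r) s = 1 := by
  have h2 := c.sum_answer j s
  rwa [Fintype.sum_sum_type, Finset.sum_eq_zero, zero_add] at h2
  intro x _
  rw [h, if_neg]
  rw [hs]
  exact (x.2 t).symm

variable {ω : Fin n → Fin 2 → Fin 2 → ℂ} {hω : ∀ j, Orthonormal ℂ (ambiguousVector ω j)}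

/-- The distribution of an ambiguous output, given that all sources have the colors of a ring. -/
theorem integral_answer_inr_mul_box (hn : 3 < n) (hχ : IsFairColoring χ)
    (hP : ∀ a, c.prob a = (completeStrategy ω hω).prob a)
    (h : ∀ᵐ s ∂c.joint, ∀ j x,
      c.answer j (Sum.inl x) s = if received j (fun e => χ e (s e)) = x.1 then 1 else 0)
    (j : Fin n) (r t : Fin 2) :
    ∫ s, c.answer j (Sum.inr r) s * c.box χ (ringColoring n t) Finset.univ s ∂c.joint
      = ‖ω j r t‖ ^ 2 * (1 / 2) ^ Fintype.card (CompleteSource n) := by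
  obtain ⟨e, he, -⟩ := exists_isBoundary (by omega : 1 < n) j
  obtain ⟨j', hj', he'⟩ : ∃ j', j ≠ j' ∧ (completeNetwork n).Conn e j' := by
    rcases he with h | h
    · exact ⟨e.1.2, fun h' => e.2.ne (h.trans h'), Or.inr rfl⟩
    · exact ⟨e.1.1, fun h' => e.2.ne (h'.symm.trans h.symm), Or.inl rfl⟩
  -- The color of the single source `e` tells the two ring words of `j` apart, so the output
  -- "constant `b`" of `j'` selects `t` among the ambiguous cases of `j`.
  let b := ringWord j t ⟨e, he⟩
  let T := (sources j').erase e
  let f : (∀ e, c.S e) → ℝ := fun s =>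
    c.answer j (Sum.inr r) s * c.box χ (ringColoring n t) (sources j) s
  have hfm : Measurable f := (c.measurable_answer j _).mul (measurable_box _ _ hχ.measurable)
  have hfS : DependsOn f (sources j : Set (CompleteSource n)) := fun s t h => by
    simp only [f, c.dependsOn_answer j _ h, dependsOn_box (c := c) (χ := χ) _ _ h]
  have hbT (s) : c.box χ (fun _ => b) (sources j') s
      = c.box χ (fun _ => b) {e} s * c.box χ (fun _ => b) T s := by
    rw [← box_union _ (by simp [T]), ← Finset.insert_eq, Finset.insert_erase (mem_sources.2 he')]
  have hbe (s) : c.box χ (fun _ => b) {e} s = if χ e (s e) = b then 1 else 0 := by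
    simp [box]
  have hbK (s) : c.box χ (ringColoring n t) (sources j) s
      = if received j (fun e => χ e (s e)) = ringWord j t then 1 else 0 := box_sources χ _ j s
  have hring {κ : CompleteSource n → Fin 2} {t'} (h1 : κ e = b)
      (h2 : received j κ = ringWord j t') : t' = t :=
    ringWord_apply_injective j ⟨e, he⟩ ((congrFun h2 ⟨e, he⟩).symm.trans h1)
  have hring' {κ : CompleteSource n → Fin 2} (h2 : received j κ = ringWord j t) : κ e = b :=
    congrFun h2 ⟨e, he⟩
  have lhs : ∫ s, c.answer j (Sum.inr r) s * c.answer j' (Sum.inl (constOutput hn b j')) s ∂c.joint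
      = (∫ s, f s ∂c.joint) * (1 / 2) ^ T.card := by
    rw [← hχ.integral_box (fun _ => b) T, ← integral_mul_of_dependsOn_disjoint _
      (disjoint_sources_erase hj' he he') hfm (measurable_box _ _ hχ.measurable) hfS
      (dependsOn_box _ _)]
    refine integral_congr_ae ?_
    filter_upwards [h] with s hs
    have h1 : c.answer j' (Sum.inl (constOutput hn b j')) s
        = c.box χ (fun _ => b) (sources j') s := by
      rw [hs, box_sources]
      rfl
    rw [h1, hbT, ← mul_assoc]
    congr 1
    simp only [f, hbK, hbe]
    by_cases h3 : ∃ t', received j (fun e => χ e (s e)) = ringWord j t'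
    · obtain ⟨t', h3⟩ := h3
      by_cases h4 : χ e (s e) = b
      · have := hring (κ := fun e => χ e (s e)) h4 h3
        subst this
        rw [if_pos h4, if_pos h3]
      · rw [if_neg h4, if_neg fun h5 => h4 (hring' (κ := fun e => χ e (s e)) h5)]
    · rw [answer_inr_eq_zero (hs j) (not_exists.1 h3), zero_mul, zero_mul]
  have rhs : ∫ s, c.answer j (Sum.inr r) s * c.answer j' (Sum.inl (constOutput hn b j')) s ∂c.joint
      = ‖ω j r t‖ ^ 2 * (1 / 2) ^ (sources j).card * (1 / 2) ^ T.card := by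
    rw [integral_answer_mul_answer hP hj', ← hχ.integral_comp fun κ =>
      if received j' κ = (constOutput hn b j').1 then
        ‖completeBasis ω j (Sum.inr r) (received j κ)‖ ^ 2 else 0,
      ← hχ.integral_box (fun _ => b) T, ← hχ.integral_box (ringColoring n t) (sources j),
      mul_assoc, ← integral_mul_of_dependsOn_disjoint _
      (disjoint_sources_erase hj' he he') (measurable_box _ _ hχ.measurable)
      (measurable_box _ _ hχ.measurable) (dependsOn_box _ _) (dependsOn_box _ _),
      ← integral_const_mul]
    refine integral_congr_ae (Filter.Eventually.of_forall fun s => ?_)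
    have h1 : (if received j' (fun e => χ e (s e)) = (constOutput hn b j').1 then
        ‖completeBasis ω j (Sum.inr r) (received j fun e => χ e (s e))‖ ^ 2 else 0)
        = ‖completeBasis ω j (Sum.inr r) (received j fun e => χ e (s e))‖ ^ 2 *
          c.box χ (fun _ => b) (sources j') s := by
      rw [box_sources, mul_ite, mul_one, mul_zero]
      rfl
    simp only
    rw [h1, hbT, ← mul_assoc, ← mul_assoc]
    congr 1
    rw [hbe, hbK]
    by_cases h4 : χ e (s e) = b
    · by_cases h3 : received j (fun e => χ e (s e)) = ringWord j t
      · rw [if_pos h4, if_pos h3, h3]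
        simp only [completeBasis, ambiguousVector_ringWord (by omega : 1 < n)]
      · rw [if_neg h3, mul_zero, completeBasis, ambiguousVector_apply, Finset.sum_eq_zero]
        · simp
        · intro t' _
          refine if_neg fun h5 => h3 ?_
          rw [← hring (κ := fun e => χ e (s e)) h4 h5, h5]
    · rw [if_neg h4, if_neg fun h5 => h4 (hring' (κ := fun e => χ e (s e)) h5), mul_zero, mul_zero]
  -- The sources of `j'` other than `e` contribute the same positive factor to both evaluations and
  -- cancel.
  have hf : ∫ s, f s ∂c.joint = ‖ω j r t‖ ^ 2 * (1 / 2) ^ (sources j).card :=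
    mul_right_cancel₀ (by positivity) (lhs.symm.trans rhs)
  -- The sources not connected to `j` are independent of `f`, so the ring coloring may be imposed on
  -- them at the cost of one factor `1 / 2` each.
  rw [← Finset.card_add_card_compl (sources j), pow_add, ← mul_assoc, ← hf,
    ← hχ.integral_box (ringColoring n t) (sources j)ᶜ, ← integral_mul_of_dependsOn_disjoint _
      disjoint_compl_right hfm (measurable_box _ _ hχ.measurable) hfS (dependsOn_box _ _)]
  refine integral_congr_ae (Filter.Eventually.of_forall fun s => ?_)
  simp only [f]
  rw [mul_assoc, ← box_union _ disjoint_compl_right, Finset.union_compl]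

end ClassicalStrategy

/-- Since `p j₀ 1 * p j 1 = (p j₀ 1 + p j 1 - 1) + p j₀ 0 * p j 0`, it suffices to bound `p j₀ 0` by
the sum of the last terms. The vanishing product means that either `p j₀ 0 = 0`, or some other party
has `p j 1 = 0` and hence `p j 0 = 1`. -/
theorem hardy_inequality {J : Type} [Fintype J] [DecidableEq J] (j₀ : J) {p : J → Fin 2 → ℝ}
    (hp : ∀ j b, 0 ≤ p j b) (hp1 : ∀ j, ∑ b, p j b = 1)
    (h0 : ∏ j, p j (if j = j₀ then 0 else 1) = 0) :
    ∑ j ∈ Finset.univ.erase j₀, (p j₀ 1 + p j 1 - 1) + p j₀ 0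
      ≤ ∑ j ∈ Finset.univ.erase j₀, p j₀ 1 * p j 1 := by
  simp only [Fin.sum_univ_two] at hp1
  have key : p j₀ 0 ≤ ∑ j ∈ Finset.univ.erase j₀, p j₀ 0 * p j 0 := by
    obtain ⟨j, -, hj⟩ := Finset.prod_eq_zero_iff.1 h0
    by_cases h : j = j₀
    · subst h
      rw [if_pos rfl] at hj
      simp [hj]
    · rw [if_neg h] at hj
      refine le_trans (le_of_eq ?_) (Finset.single_le_sum (f := fun j => p j₀ 0 * p j 0)
        (fun j _ => mul_nonneg (hp _ _) (hp _ _)) (Finset.mem_erase.2 ⟨h, Finset.mem_univ j⟩))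
      rw [show p j 0 = 1 by linarith [hp1 j], mul_one]
  have e : ∑ j ∈ Finset.univ.erase j₀, p j₀ 1 * p j 1
      = ∑ j ∈ Finset.univ.erase j₀, (p j₀ 1 + p j 1 - 1)
        + ∑ j ∈ Finset.univ.erase j₀, p j₀ 0 * p j 0 := by
    rw [← Finset.sum_add_distrib]
    refine Finset.sum_congr rfl fun j _ => ?_
    rw [show p j₀ 0 = 1 - p j₀ 1 by linarith [hp1 j₀], show p j 0 = 1 - p j 1 by linarith [hp1 j]]
    ring
  linarith

/-- If the distribution is local and the ambiguous outcome `0` at `j₀` and `1` elsewhere is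
impossible, the parameters of the rotated bases satisfy a Hardy-type inequality. -/
theorem hardy_inequality_of_isLocal {n : ℕ} (hn : 3 < n) {x y : Fin n → ℝ}
    (hxy : ∀ j, x j ^ 2 + y j ^ 2 = 1)
    (hω : ∀ j, Orthonormal ℂ (ambiguousVector (fun j r t => (rotationCoeff x y j r t : ℂ)) j))
    (hloc : IsLocal.{u} (completeNetwork n)
      (completeStrategy (fun j r t => (rotationCoeff x y j r t : ℂ)) hω).prob) (j₀ : Fin n)
    (h0 : ∑ t, ∏ j, rotationCoeff x y j (if j = j₀ then 0 else 1) t = 0) :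
    ∑ j ∈ Finset.univ.erase j₀, (x j₀ ^ 2 + x j ^ 2 - 1) + y j₀ ^ 2
      ≤ ∑ j ∈ Finset.univ.erase j₀, (y j₀ ^ 2 * y j ^ 2 + x j₀ ^ 2 * x j ^ 2) := by
  obtain ⟨c, hP⟩ := hloc
  obtain ⟨χ, hχ, h⟩ := c.exists_coloring hn hP
  let R (j : Fin n) (r : Fin 2) : (∀ e, c.S e) → ℝ := c.answer j (Sum.inr r)
  let T := c.box χ (ringColoring n 1) Finset.univ
  have hR0 (j r s) : 0 ≤ R j r s := (c.answer_mem j _ s).1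
  have hR1 (j r s) : R j r s ≤ 1 := (c.answer_mem j _ s).2
  have hRm (j r) : Measurable (R j r) := c.measurable_answer j _
  have hT (s) : T s ∈ Set.Icc (0 : ℝ) 1 := ClassicalStrategy.box_mem _ _ s
  have hTm : Measurable T := ClassicalStrategy.measurable_box _ _ hχ.measurable
  have hTi : Integrable T c.joint := c.integrable_of_mem hTm hT
  have hRT (j r) : Integrable (fun s => R j r s * T s) c.joint :=
    c.integrable_of_mem ((hRm j r).mul hTm) fun s =>
      ⟨mul_nonneg (hR0 j r s) (hT s).1, mul_le_one₀ (hR1 j r s) (hT s).1 (hT s).2⟩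
  have hRRT (j) : Integrable (fun s => R j₀ 1 s * R j 1 s * T s) c.joint :=
    c.integrable_of_mem (((hRm j₀ 1).mul (hRm j 1)).mul hTm) fun s =>
      ⟨mul_nonneg (mul_nonneg (hR0 _ _ s) (hR0 j _ s)) (hT s).1,
        mul_le_one₀ (mul_le_one₀ (hR1 _ _ s) (hR0 j _ s) (hR1 j _ s)) (hT s).1 (hT s).2⟩
  let q : ℝ := (1 / 2) ^ Fintype.card (CompleteSource n)
  have hq : 0 < q := by positivity
  have hTq : ∫ s, T s ∂c.joint = q := by
    rw [hχ.integral_box, Finset.card_univ]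
  have hRTq (j r) : ∫ s, R j r s * T s ∂c.joint = rotationCoeff x y j r 1 ^ 2 * q := by
    rw [ClassicalStrategy.integral_answer_inr_mul_box hn hχ hP h, Complex.norm_real,
      Real.norm_eq_abs, sq_abs]
  have hsum : ∀ᵐ s ∂c.joint, T s = 0 ∨ T s = 1 ∧ ∀ j, ∑ r, R j r s = 1 := by
    filter_upwards [h] with s hs
    by_cases hc : ∀ e, χ e (s e) = ringColoring n 1 e
    · refine Or.inr ⟨?_, fun j => ClassicalStrategy.sum_answer_inr (hs j) (t := 1) ?_⟩
      · simp only [T]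
        rw [ClassicalStrategy.box_eq, if_pos fun e _ => hc e]
      · rw [← received_ringColoring]
        exact funext fun e => hc e.1
    · refine Or.inl ?_
      simp only [T]
      rw [ClassicalStrategy.box_eq, if_neg]
      exact fun h => hc fun e => h e (Finset.mem_univ e)
  have hzero : ∀ᵐ s ∂c.joint, ∏ j, R j (if j = j₀ then 0 else 1) s = 0 := by
    refine (integral_eq_zero_iff_of_nonneg (fun s => (c.prod_answer_mem _ s).1)
      (c.integrable_prod_answer _)).1 ?_
    refine (hP fun j => Sum.inr (if j = j₀ then 0 else 1)).trans ?_
    rw [completeStrategy_prob_inr (by omega), h0]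
    simp
  -- On `T` all parties are ambiguous, so summing over the outputs of the others loses nothing
  -- there. Off `T` the summands are nonnegative; this discards the share of the ring coloring `0`,
  -- which the distribution does not separate from that of `1`.
  have hpair (j) (hj : j ≠ j₀) : ∫ s, R j₀ 1 s * R j 1 s * T s ∂c.joint
      ≤ q * (y j₀ ^ 2 * y j ^ 2 + x j₀ ^ 2 * x j ^ 2) := by
    have hi (r : Fin n → Fin 2) : Integrable
        (fun s => if r j₀ = 1 ∧ r j = 1 then ∏ i, R i (r i) s else 0) c.joint := by
      split_ifs
      · exact c.integrable_prod_answer _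
      · exact integrable_zero _ _ _
    rw [← sum_completeStrategy_prob_inr_pair (by omega) hxy hω hj.symm]
    have e1 : ∑ r : Fin n → Fin 2, (if r j₀ = 1 ∧ r j = 1 then
        (completeStrategy (fun j r t => (rotationCoeff x y j r t : ℂ)) hω).prob
          (fun i => Sum.inr (r i)) else 0)
        = ∫ s, ∑ r : Fin n → Fin 2, (if r j₀ = 1 ∧ r j = 1 then ∏ i, R i (r i) s else 0)
          ∂c.joint := by
      rw [integral_finsetSum _ fun r _ => hi r]
      refine Finset.sum_congr rfl fun r _ => ?_
      split_ifs
      · exact (hP _).symm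
      · simp
    rw [e1]
    refine integral_mono_ae (hRRT j) (integrable_finsetSum _ fun r _ => hi r) ?_
    filter_upwards [hsum] with s hs
    rcases hs with hs | ⟨hs, hs'⟩
    · simp only [hs, mul_zero]
      refine Finset.sum_nonneg fun r _ => ?_
      split_ifs
      · exact Finset.prod_nonneg fun i _ => hR0 i _ s
      · exact le_rfl
    · simp only [hs, mul_one]
      exact (sum_ite_prod_pair (fun i b => R i b s) hj.symm 1 1 fun k _ _ => hs' k).ge
  have hi (j) : Integrable (fun s => R j₀ 1 s * T s + R j 1 s * T s - T s) c.joint :=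
    ((hRT j₀ 1).add (hRT j 1)).sub hTi
  have hle : ∫ s, (∑ j ∈ Finset.univ.erase j₀, (R j₀ 1 s * T s + R j 1 s * T s - T s)
        + R j₀ 0 s * T s) ∂c.joint
      ≤ ∫ s, ∑ j ∈ Finset.univ.erase j₀, R j₀ 1 s * R j 1 s * T s ∂c.joint := by
    refine integral_mono_ae ((integrable_finsetSum _ fun j _ => hi j).add (hRT j₀ 0))
      (integrable_finsetSum _ fun j _ => hRRT j) ?_
    filter_upwards [hsum, hzero] with s hs hs0
    rcases hs with hs | ⟨hs, hs'⟩
    · simp [hs]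
    · simp only [hs, mul_one]
      exact hardy_inequality j₀ (p := fun j r => R j r s) (fun j r => hR0 j r s) hs' hs0
  rw [integral_add (integrable_finsetSum _ fun j _ => hi j) (hRT j₀ 0), integral_finsetSum _ fun j _ => hi j,
    integral_finsetSum _ fun j _ => hRRT j] at hle
  have hterm (j) : ∫ s, (R j₀ 1 s * T s + R j 1 s * T s - T s) ∂c.joint
      = q * (x j₀ ^ 2 + x j ^ 2 - 1) := by
    rw [integral_sub (f := fun s => R j₀ 1 s * T s + R j 1 s * T s)
      ((hRT j₀ 1).add (hRT j 1)) hTi, integral_add (hRT j₀ 1) (hRT j 1), hRTq, hRTq,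
      hTq]
    simp only [rotationCoeff, Matrix.cons_val_one, Matrix.cons_val_fin_one]
    ring
  have hlast : ∫ s, R j₀ 0 s * T s ∂c.joint = q * y j₀ ^ 2 := by
    rw [hRTq]
    simp only [rotationCoeff, Matrix.cons_val_zero, Matrix.cons_val_one, Matrix.cons_val_fin_one]
    ring
  have hle2 := hle.trans (Finset.sum_le_sum fun j hj => hpair j (Finset.ne_of_mem_erase hj))
  simp only [hterm, hlast, ← Finset.mul_sum, ← mul_add] at hle2
  exact le_of_mul_le_mul_left hle2 hq

/-- The cancellation says that the ratio `y₀ / x₀` is the `m`-th power of `y / x`. The ratio `y / x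
= 1 / (2 * m)` is small enough for the last inequality, as `2 * m * y ^ 2 = x ^ 2 / (2 * m)`. -/
theorem exists_rotation_parameters {m : ℕ} (hm : 0 < m) :
    ∃ x y x₀ y₀ : ℝ, x ^ 2 + y ^ 2 = 1 ∧ x₀ ^ 2 + y₀ ^ 2 = 1 ∧ x₀ * y ^ m = y₀ * x ^ m ∧
      0 < y₀ ∧ 2 * m * y ^ 2 < 1 := by
  have unit (τ : ℝ) : ∃ x : ℝ, 0 < x ∧ x ^ 2 ≤ 1 ∧ x ^ 2 + (τ * x) ^ 2 = 1 := by
    have h : (0 : ℝ) < 1 + τ ^ 2 := by positivity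
    have e : (1 / Real.sqrt (1 + τ ^ 2)) ^ 2 = 1 / (1 + τ ^ 2) := by
      rw [div_pow, Real.sq_sqrt h.le, one_pow]
    refine ⟨1 / Real.sqrt (1 + τ ^ 2), by positivity, ?_, ?_⟩
    · rw [e, div_le_one h]
      nlinarith [sq_nonneg τ]
    · rw [mul_pow, e]
      field_simp
  have hm' : (1 : ℝ) ≤ m := by exact_mod_cast hm
  obtain ⟨x, hx, hx1, hxy⟩ := unit (1 / (2 * m))
  obtain ⟨x₀, hx0, -, hxy0⟩ := unit ((1 / (2 * m)) ^ m)
  refine ⟨x, _, x₀, _, hxy, hxy0, ?_, by positivity, ?_⟩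
  · rw [mul_pow]
    ring
  · have e : 2 * m * (1 / (2 * m) * x) ^ 2 = x ^ 2 / (2 * m) := by
      field_simp
    rw [e, div_lt_one (by positivity)]
    linarith

end Nonlocality

theorem mainTheorem4 (n : ℕ) (hn : 3 < n) :
    ∃ (ω : Fin n → Fin 2 → Fin 2 → ℂ) (hω : ∀ j, Orthonormal ℂ (ambiguousVector ω j)),
      (completeStrategy ω hω).IsColorMatching 2 (fun _ => 1 / 2) ∧
      ¬ IsLocal.{u} (completeNetwork n) (completeStrategy ω hω).prob := by
  obtain ⟨x, y, x₀, y₀, hxy, hxy0, hzero, hy0, hlt⟩ :=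
    exists_rotation_parameters (by omega : 0 < n - 1)
  let j₀ : Fin n := ⟨0, by omega⟩
  let X : Fin n → ℝ := fun j => if j = j₀ then x₀ else x
  let Y : Fin n → ℝ := fun j => if j = j₀ then y₀ else y
  have hXY (j) : X j ^ 2 + Y j ^ 2 = 1 := by
    simp only [X, Y]
    split_ifs
    · exact hxy0
    · exact hxy
  have hω := orthonormal_rotationCoeff (by omega : 1 < n) hXY
  have hX0 : X j₀ = x₀ := if_pos rfl
  have hY0 : Y j₀ = y₀ := if_pos rfl
  have hcard : (Finset.univ.erase j₀).card = n - 1 := by simp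
  refine ⟨_, hω, completeStrategy_isColorMatching hn _ hω, fun hloc => ?_⟩
  -- The two ring colorings contribute `x₀ * y ^ (n - 1)` and `-y₀ * x ^ (n - 1)`.
  have hamp : ∑ t, ∏ j, rotationCoeff X Y j (if j = j₀ then 0 else 1) t = 0 := by
    have e (t : Fin 2) : ∏ j, rotationCoeff X Y j (if j = j₀ then 0 else 1) t
        = (if t = 0 then x₀ else -y₀) * (if t = 0 then y else x) ^ (n - 1) := by
      rw [← Finset.mul_prod_erase _ _ (Finset.mem_univ j₀), ← hcard]
      congr 1
      · fin_cases t <;> simp [rotationCoeff, hX0, hY0]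
      · refine Finset.prod_eq_pow_card fun j hj => ?_
        have hj' := Finset.ne_of_mem_erase hj
        fin_cases t <;> simp [rotationCoeff, X, Y, hj']
    simp only [e, Fin.sum_univ_two, if_true, one_ne_zero, if_false]
    linarith
  have main := hardy_inequality_of_isLocal hn hXY hω hloc j₀ hamp
  have e (f : ℝ → ℝ → ℝ) : ∑ j ∈ Finset.univ.erase j₀, f (X j) (Y j) = (n - 1 : ℕ) * f x y := by
    rw [← hcard, ← nsmul_eq_mul]
    refine Finset.sum_eq_card_nsmul fun j hj => ?_
    simp only [X, Y, if_neg (Finset.ne_of_mem_erase hj)]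
  rw [e fun a b => X j₀ ^ 2 + a ^ 2 - 1, e fun a b => Y j₀ ^ 2 * b ^ 2 + X j₀ ^ 2 * a ^ 2, hX0,
    hY0] at main
  have hx : x ^ 2 = 1 - y ^ 2 := by linarith
  have hx0 : x₀ ^ 2 = 1 - y₀ ^ 2 := by linarith
  rw [hx, hx0] at main
  -- After eliminating `x` and `x₀`, each ordinary party contributes `1 - y₀ ^ 2 - y ^ 2` on the
  -- left and the same plus `2 * y₀ ^ 2 * y ^ 2` on the right.
  have h2 : y₀ ^ 2 * 1 ≤ y₀ ^ 2 * (2 * (n - 1 : ℕ) * y ^ 2) := by linarith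
  exact absurd (le_of_mul_le_mul_left h2 (by positivity)) (not_le.2 hlt)
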